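/- Let $n_1,n_2,\varkappa\ge 1$ be integers. Write $x=(x',x'')\in\mathbb R^{n_1}\times\mathbb R^{n_2}$, $Q=n_1+(1+\varkappa)n_2$, and let $$d(x,y)=|x'-y'|+\begin{cases}\dfrac{|x''-y''|}{(|x'|+|y'|)^{\varkappa}} & \text{if } |x''-y''|^{1/(1+\varkappa)}\le |x'|+|y'|,\\[2mm] |x''-y''|^{1/(1+\varkappa)} & \text{otherwise}\end{cases}$$ (the first case is read as $0$ when $x'=y'=0$ and $x''=y''$). Put $B(x,r)=\{y: d(x,y)<r\}$, let $|\cdot|$ be Lebesgue measure, and let $C_0>1$ be such that $d(x,y)\le C_0(d(x,z)+d(z,y))$ for all $x,y,z$. Let $G=-\Delta_{x'}-V(x')\Delta_{x''}$ be the self-adjoint Grushin operator on $L^2(\mathbb R^{n_1+n_2})$, where $V(x')$ is either $|x'|^{2\varkappa}$ or $\sum_j (x'_j)^{2\varkappa}$, and let $\chi_0(G)=\mathbf 1_{[0,1)}(G)$, $\chi_j(G)=\mathbf 1_{[2^{j-1},2^j)}(G)$ for $j\ge1$ be its dyadic spectral projections. Let $X=(X_j,X_{\alpha,k})$ be the gradient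 with $X_j=\partial_{x'_j}$ and $X_{\alpha,k}=(x')^\alpha\partial_{x''_k}$, $1\le j\le n_1$, $1\le k\le n_2$, $\alpha\in\mathbb N^{n_1}$, $|\alpha|=\varkappa$. Let $T$ be a bounded linear operator on $L^2(\mathbb R^{n_1+n_2})$ and let $T_j=T\circ\chi_j(G)$, $j\in\mathbb N$, have integral kernels $T_j(x,y)$, differentiable in $x$. Suppose that for some $R_0>Q$ there is a constant $A$, and for every $\mathcal K_0>0$ a constant $A_{\mathcal K_0}$, such that for all $j\in\mathbb N$ and $\mathfrak r\in[0,R_0]$ $$|B(x,2^{-j/2})|^{1/2}|B(y,2^{-j/2})|^{1/2}\,d(x,y)^{\mathfrak r}\,|T_j(x,y)|\le A\,2^{-j\mathfrak r/2}\quad\text{for all }x,y,$$ $$|B(x,2^{-j/2})|^{1/2}|B(y,2^{-j/2})|^{1/2}\,d(x,y)^{\mathfrak r}\,|X_xT_j(x,y)|\le A_{\mathcal K_0}\,2^{-j\mathfrak r/2}2^{j/2}\quad\text{whenever } d(x,y)<\mathcal K_0 .$$ Let $C_1\ge1$ and $0<\delta_0<1$, and let $s=8C_1C_0^3/\delta_0$.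 (In particular $C_1$ may be the constant $C_{1,\varkappa}$ of the mean-value inequality for $X$, for which any two points of a ball $B(x_0,r)$ are joined by a length-minimising curve inside $B(x_0,C_{1,\varkappa}r)$, so that $C_{1,\varkappa}\ge1$; and $\delta_0$ may be the ratio of a system of dyadic cubes of $(\mathbb R^{n_1+n_2},d,|\cdot|)$.) Define $$\mathcal M^{\#}_{T,s}f(x)=\sup_{B\ni x}\ \operatorname*{ess\,sup}_{y,z\in B}\bigl|T(f\mathbf 1_{(sB)^c})(y)-T(f\mathbf 1_{(sB)^c})(z)\bigr|,\qquad \mathcal Mf(x)=\sup_{B\ni x}\frac1{|B|}\int_B|f|,$$ the suprema being over all balls $B=B(c,r)$ containing $x$, with $sB=B(c,sr)$. Then: 1. There is a constant $C<\infty$ such that for every bounded measurable function $f$ with compact support, $\mathcal M^{\#}_{T,s}f(x)\le C\,\mathcal Mf(x)$ for almost every $x$. 2. Consequently $\mathcal M^{\#}_{T,s}$ is of weak type $(1,1)$: there is a constant $C<\infty$ such that $|\{x:\mathcal M^{\#}_{T,s}f(x)>t\}|\le \frac Ct\|f\|_{L^1}$ for all $f\in L^1\cap L^2$ and all $t>0$.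 -/

import Mathlib

open MeasureTheory
open scoped ENNReal NNReal ContDiff

noncomputable section

namespace Grushin

/-- `ℝ^{n₁} × ℝ^{n₂}`, points `x = (x', x'')`, with Lebesgue measure `volume`. -/
abbrev Space (n₁ n₂ : ℕ) : Type :=
  EuclideanSpace ℝ (Fin n₁) × EuclideanSpace ℝ (Fin n₂)

/-- The complex Hilbert space `L²(ℝ^{n₁+n₂})`. -/
abbrev L2 (n₁ n₂ : ℕ) : Type :=
  Lp ℂ 2 (volume : Measure (Space n₁ n₂))

/-! ### Distance, balls, and maximal function -/

/-- The Grushin (quasi-)distance. When `|x'| + |y'| = 0` the first branch is only taken for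
`x'' = y''`, where its value is `0`. -/
def dist (ϰ : ℕ) {n₁ n₂ : ℕ} (x y : Space n₁ n₂) : ℝ :=
  ‖x.1 - y.1‖ +
    if ‖x.2 - y.2‖ ^ (1 / (1 + (ϰ : ℝ))) ≤ ‖x.1‖ + ‖y.1‖ then
      ‖x.2 - y.2‖ / (‖x.1‖ + ‖y.1‖) ^ ϰ
    else
      ‖x.2 - y.2‖ ^ (1 / (1 + (ϰ : ℝ)))

/-- The ball `B(c, r)` of the Grushin distance. -/
def ball (ϰ : ℕ) {n₁ n₂ : ℕ} (c : Space n₁ n₂) (r : ℝ) : Set (Space n₁ n₂) :=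
  {y | dist ϰ c y < r}

/-- The Lebesgue measure `|B(c, r)|`. -/
def ballVol (ϰ : ℕ) {n₁ n₂ : ℕ} (c : Space n₁ n₂) (r : ℝ) : ℝ :=
  volume.real (ball ϰ c r)

/-- The homogeneous dimension `Q = n₁ + (1 + ϰ) n₂`. -/
def homDim (ϰ n₁ n₂ : ℕ) : ℝ := n₁ + (1 + ϰ) * n₂

/-- The uncentered Hardy–Littlewood maximal function: the supremum over all balls `B ∋ x` of the
mean of `|f|` over `B`. -/
def maximal (ϰ : ℕ) {n₁ n₂ : ℕ} (f : Space n₁ n₂ → ℂ) (x : Space n₁ n₂) : ℝ≥0∞ :=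
  ⨆ (c : Space n₁ n₂) (r : ℝ) (_ : 0 < r) (_ : x ∈ ball ϰ c r),
    (volume (ball ϰ c r))⁻¹ * ∫⁻ y in ball ϰ c r, ‖f y‖ₑ

/-! ### Operators on `L²` -/

open Classical in
/-- A bounded operator of `L²` applied to a function; the value is a representative of `T g` when
`g` is square integrable (and `0` otherwise). -/
def applyFun {n₁ n₂ : ℕ} (T : L2 n₁ n₂ →L[ℂ] L2 n₁ n₂) (g : Space n₁ n₂ → ℂ) :
    Space n₁ n₂ → ℂ :=
  if h : MemLp g 2 volume then (T (h.toLp g) : Space n₁ n₂ → ℂ) else 0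

/-- The grand maximal truncated operator: the supremum over all balls `B = B(c, r) ∋ x` of the
essential supremum over `(y, z) ∈ B × B` of `|T(f 1_{(sB)ᶜ})(y) - T(f 1_{(sB)ᶜ})(z)|`, where
`sB = B(c, s r)`. -/
def grandMaximal (ϰ : ℕ) {n₁ n₂ : ℕ} (T : L2 n₁ n₂ →L[ℂ] L2 n₁ n₂) (s : ℝ)
    (f : Space n₁ n₂ → ℂ) (x : Space n₁ n₂) : ℝ≥0∞ :=
  ⨆ (c : Space n₁ n₂) (r : ℝ) (_ : 0 < r) (_ : x ∈ ball ϰ c r),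
    essSup
      (fun p : Space n₁ n₂ × Space n₁ n₂ =>
        ‖applyFun T ((ball ϰ c (s * r))ᶜ.indicator f) p.1 -
          applyFun T ((ball ϰ c (s * r))ᶜ.indicator f) p.2‖ₑ)
      ((volume.restrict (ball ϰ c r)).prod (volume.restrict (ball ϰ c r)))

/-- Bounded measurable functions with compact support. -/
def IsBddCompactlySupported {n₁ n₂ : ℕ} (f : Space n₁ n₂ → ℂ) : Prop :=
  Measurable f ∧ (∃ M : ℝ, ∀ x, ‖f x‖ ≤ M) ∧ HasCompactSupport f

/-- `K` is an integral kernel of `A`: `A f(x) = ∫ K(x, y) f(y) dy` for almost every `x`, with an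
absolutely convergent integral, for all bounded measurable `f` with compact support. -/
def IsIntegralKernel {n₁ n₂ : ℕ} (A : L2 n₁ n₂ →L[ℂ] L2 n₁ n₂)
    (K : Space n₁ n₂ → Space n₁ n₂ → ℂ) : Prop :=
  AEStronglyMeasurable (Function.uncurry K) (volume.prod volume) ∧
    ∀ f : Space n₁ n₂ → ℂ, IsBddCompactlySupported f →
      ∀ᵐ x, Integrable (fun y => K x y * f y) volume ∧
        applyFun A f x = ∫ y, K x y * f y

/-! ### The Grushin operator and its spectral projections -/

/-- The two admissible choices of the potential `V_ϰ`. -/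
inductive Potential
  /-- `V_ϰ(x') = |x'|^{2ϰ}` -/
  | radial
  /-- `V_ϰ(x') = ∑_j (x'_j)^{2ϰ}` -/
  | separable

/-- The value `V_ϰ(x')`. -/
def Potential.eval (V : Potential) (ϰ : ℕ) {n₁ : ℕ} (x' : EuclideanSpace ℝ (Fin n₁)) : ℝ :=
  match V with
  | .radial => ‖x'‖ ^ (2 * ϰ)
  | .separable => ∑ j, x' j ^ (2 * ϰ)

/-- `∂φ/∂x'_j`. -/
def partial₁ {n₁ n₂ : ℕ} (j : Fin n₁) (φ : Space n₁ n₂ → ℂ) (x : Space n₁ n₂) : ℂ :=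
  fderiv ℝ φ x (EuclideanSpace.single j 1, 0)

/-- `∂φ/∂x''_k`. -/
def partial₂ {n₁ n₂ : ℕ} (k : Fin n₂) (φ : Space n₁ n₂ → ℂ) (x : Space n₁ n₂) : ℂ :=
  fderiv ℝ φ x (0, EuclideanSpace.single k 1)

/-- The Hilbert space in which the graph of `φ ↦ (∇_{x'} φ, √V ∇_{x''} φ)` lies: the component
`none` carries `φ`, the others carry the components of the gradient. -/
abbrev GraphSpace (n₁ n₂ : ℕ) : Type :=
  PiLp 2 (fun _ : Option (Fin n₁ ⊕ Fin n₂) => L2 n₁ n₂)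

/-- The elements `(φ, ∇_{x'} φ, √V ∇_{x''} φ)`, for `φ` a smooth function with compact support. -/
def testGraph (V : Potential) (ϰ n₁ n₂ : ℕ) : Set (GraphSpace n₁ n₂) :=
  {p | ∃ φ : Space n₁ n₂ → ℂ, ContDiff ℝ ∞ φ ∧ HasCompactSupport φ ∧
    p none =ᵐ[volume] φ ∧
    (∀ j, p (some (Sum.inl j)) =ᵐ[volume] partial₁ j φ) ∧
    (∀ k, p (some (Sum.inr k)) =ᵐ[volume]
      fun x => (Real.sqrt (V.eval ϰ x.1) : ℂ) * partial₂ k φ x)}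

/-- The domain of the closure of the quadratic form
`⟨G φ, φ⟩ = ∫ |∇_{x'} φ|² + V(x') |∇_{x''} φ|²`, initially given on `C_c^∞`, as a Hilbert space
with the inner product `⟨φ, ψ⟩ + ⟨∇_{x'} φ, ∇_{x'} ψ⟩ + ⟨√V ∇_{x''} φ, √V ∇_{x''} ψ⟩`. -/
def formDomain (V : Potential) (ϰ n₁ n₂ : ℕ) : Submodule ℂ (GraphSpace n₁ n₂) :=
  (Submodule.span ℂ (testGraph V ϰ n₁ n₂)).topologicalClosure

instance (V : Potential) (ϰ n₁ n₂ : ℕ) : CompleteSpace (formDomain V ϰ n₁ n₂) :=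
  inferInstanceAs
    (CompleteSpace (Submodule.span ℂ (testGraph V ϰ n₁ n₂)).topologicalClosure)

/-- The inclusion of the form domain into `L²`. -/
def formIncl (V : Potential) (ϰ n₁ n₂ : ℕ) : formDomain V ϰ n₁ n₂ →L[ℂ] L2 n₁ n₂ :=
  (PiLp.proj (𝕜 := ℂ) 2 (fun _ : Option (Fin n₁ ⊕ Fin n₂) => L2 n₁ n₂) none).comp
    (formDomain V ϰ n₁ n₂).subtypeL

/-- The resolvent `(1 + G)⁻¹` of the self-adjoint Grushin operator
`G = -Δ_{x'} - V(x') Δ_{x''}`, the operator of the closed form above. Writing `ι` for the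
inclusion of the form domain, `u = ι† g` is the unique element of the form domain with
`⟨u, w⟩ + ⟨∇_{x'} u, ∇_{x'} w⟩ + ⟨√V ∇_{x''} u, √V ∇_{x''} w⟩ = ⟨g, w⟩` for all `w` in the form
domain, that is `(1 + G) u = g`. -/
def resolvent (V : Potential) (ϰ n₁ n₂ : ℕ) : L2 n₁ n₂ →L[ℂ] L2 n₁ n₂ :=
  (formIncl V ϰ n₁ n₂).comp (ContinuousLinearMap.adjoint (formIncl V ϰ n₁ n₂))

/-- For a self-adjoint `A` and an open `U ⊆ ℝ`, the range of the spectral projection `1_U(A)`: the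
closed span of the ranges of all `g(A)` with `g` continuous and zero outside `U`. -/
def spectralSubspace {H : Type*} [NormedAddCommGroup H] [InnerProductSpace ℂ H]
    [CompleteSpace H] (A : H →L[ℂ] H) (U : Set ℝ) : Submodule ℂ H :=
  (⨆ g ∈ {g : ℝ → ℝ | Continuous g ∧ ∀ t ∉ U, g t = 0},
    LinearMap.range (cfc g A).toLinearMap).topologicalClosure

instance {H : Type*} [NormedAddCommGroup H] [InnerProductSpace ℂ H] [CompleteSpace H]
    (A : H →L[ℂ] H) (U : Set ℝ) : CompleteSpace (spectralSubspace A U) := by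
  unfold spectralSubspace
  infer_instance

/-- The spectral projection `1_{[0, a)}(G)`, `a > 0`: since `G ≥ 0`, it is `1_U((1 + G)⁻¹)` with
`U = ((1 + a)⁻¹, ∞)`. -/
def specProjBelow (V : Potential) (ϰ n₁ n₂ : ℕ) (a : ℝ) : L2 n₁ n₂ →L[ℂ] L2 n₁ n₂ :=
  (spectralSubspace (resolvent V ϰ n₁ n₂) (Set.Ioi (1 + a)⁻¹)).starProjection

/-- The dyadic spectral projections of `G`: `χ_0(G) = 1_{[0, 1)}(G)` and
`χ_j(G) = 1_{[2^{j-1}, 2^j)}(G)` for `j ≥ 1`. -/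
def chi (V : Potential) (ϰ n₁ n₂ : ℕ) : ℕ → (L2 n₁ n₂ →L[ℂ] L2 n₁ n₂)
  | 0 => specProjBelow V ϰ n₁ n₂ 1
  | j + 1 => specProjBelow V ϰ n₁ n₂ (2 ^ (j + 1)) - specProjBelow V ϰ n₁ n₂ (2 ^ j)

/-! ### Kernel conditions -/

/-- The length `|X φ(x)|` of the gradient vector `X = (X_j, X_{α,k})`, where `X_j = ∂/∂x'_j` and
`X_{α,k} = (x')^α ∂/∂x''_k` for `1 ≤ j ≤ n₁`, `1 ≤ k ≤ n₂`, `α ∈ ℕ^{n₁}`, `|α| = ϰ`. -/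
def gradNorm (ϰ : ℕ) {n₁ n₂ : ℕ} (φ : Space n₁ n₂ → ℂ) (x : Space n₁ n₂) : ℝ :=
  Real.sqrt (∑ j, ‖partial₁ j φ x‖ ^ 2 +
    ∑ α ∈ Finset.piAntidiag (Finset.univ : Finset (Fin n₁)) ϰ, ∑ k,
      ‖((∏ i, x.1 i ^ α i : ℝ) : ℂ) * partial₂ k φ x‖ ^ 2)

/-- The pointwise size condition on the kernels `K_j`, with a constant uniform in `j ∈ ℕ`,
`𝔯 ∈ [0, R₀]` and the points. -/
def KernelSup (ϰ : ℕ) {n₁ n₂ : ℕ} (K : ℕ → Space n₁ n₂ → Space n₁ n₂ → ℂ) (R₀ : ℝ) : Prop :=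
  ∃ C : ℝ, ∀ j : ℕ, ∀ 𝔯 ∈ Set.Icc 0 R₀, ∀ x y : Space n₁ n₂,
    ballVol ϰ x (2 ^ (-(j : ℝ) / 2)) ^ (1 / 2 : ℝ) *
        ballVol ϰ y (2 ^ (-(j : ℝ) / 2)) ^ (1 / 2 : ℝ) *
        dist ϰ x y ^ 𝔯 * ‖K j x y‖
      ≤ C * 2 ^ (-((j : ℝ) * 𝔯) / 2)

/-- The pointwise condition on the `X`-gradients of the kernels `K_j` in their first variable: they
are differentiable in that variable and, for each `𝒦₀ > 0`, satisfy the bound on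
`{d(x, y) < 𝒦₀}` with a constant uniform in `j ∈ ℕ`, `𝔯 ∈ [0, R₀]` and the points. -/
def KernelGradSup (ϰ : ℕ) {n₁ n₂ : ℕ} (K : ℕ → Space n₁ n₂ → Space n₁ n₂ → ℂ) (R₀ : ℝ) :
    Prop :=
  (∀ (j : ℕ) (y : Space n₁ n₂), Differentiable ℝ (fun x => K j x y)) ∧
  ∀ 𝒦₀ : ℝ, 0 < 𝒦₀ → ∃ C : ℝ, ∀ j : ℕ, ∀ 𝔯 ∈ Set.Icc 0 R₀, ∀ x y : Space n₁ n₂,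
    dist ϰ x y < 𝒦₀ →
    ballVol ϰ x (2 ^ (-(j : ℝ) / 2)) ^ (1 / 2 : ℝ) *
        ballVol ϰ y (2 ^ (-(j : ℝ) / 2)) ^ (1 / 2 : ℝ) *
        dist ϰ x y ^ 𝔯 * gradNorm ϰ (fun u => K j u y) x
      ≤ C * (2 ^ (-((j : ℝ) * 𝔯) / 2) * 2 ^ ((j : ℝ) / 2))

end Grushin

end

/-! Away from a dilated ball, `T` has a kernel with Hölder-type regularity. For `y, z` in `B(c, r)`
and `ρ = d(c, w) ≥ s r`, the differences `K j y w - K j z w`, summed in absolute value over `j`, are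
at most a constant times `(r/ρ)^ε / |B(c, ρ)|` if `ρ < 1` and `ρ^(-ε) / |B(c, ρ)|` if `ρ ≥ 1`
(`exists_sum_norm_sub_mul_boxVol_le`). Integrated against `|f|` over dyadic annuli, such a weight
yields a geometric series times the maximal function (`exists_lintegral_decay_le_maximal`).

For the kernel estimate put `t = 2^(-j/2)`. The weighted hypotheses give size `(t/ρ)^ε / |B(c, ρ)|`:
of `R₀` powers of decay, `Q` pay for replacing balls of radius `t` by one of radius `ρ`, and `ε ≤ R₀
- Q` are left (`exists_mul_boxVol_le`). This sums over `t < r`. For `t ≥ r` the gradient hypothesis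
and a mean value inequality gain a further factor `r/t`. The gradient hypothesis is local and is
used for `ρ < 1`; for `ρ ≥ 1` the size bound alone sums, because `t ≤ 1` for every `j`.

The mean value inequality comes from an explicit path of three segments which makes its vertical
move away from the degenerate set `x' = 0` (`exists_norm_sub_le_of_gradNorm_le`).

The kernels describe `T` because the resolvent is positive with dense range, so the spectral
projections tend strongly to the identity (`tendsto_specProjBelow`) and a subsequence of the partial
sums converges almost everywhere. Truncation extends the pointwise bound from bounded compactly
supported functions to `L²`, and a Vitali covering gives the weak type of the maximal function
(`exists_volume_lt_maximal_le`). -/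

namespace Grushin

open Filter Topology

variable {n₁ n₂ : ℕ}

/-! ### Geometry of the Grushin balls -/

/-- The vertical part of the distance is `< r` exactly when the displacement is
`< r * max S r ^ ϰ`. -/
lemma vertical_lt_iff (ϰ : ℕ) {δ S r : ℝ} (hδ : 0 ≤ δ) (hS : 0 ≤ S) (hr : 0 < r) :
    (if δ ^ (1 / (1 + (ϰ : ℝ))) ≤ S then δ / S ^ ϰ else δ ^ (1 / (1 + (ϰ : ℝ)))) < r ↔
      δ < r * max S r ^ ϰ := by
  -- Substituting `δ = q^(ϰ+1)` turns the fractional power into `q` and leaves only integer powers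
  -- to compare.
  obtain ⟨q, hq, rfl⟩ : ∃ q : ℝ, 0 ≤ q ∧ δ = q ^ (ϰ + 1) := by
    refine ⟨δ ^ (1 / (1 + (ϰ : ℝ))), by positivity, ?_⟩
    rw [← Real.rpow_natCast, ← Real.rpow_mul hδ]
    push_cast
    rw [add_comm (ϰ : ℝ) 1, one_div, inv_mul_cancel₀ (by positivity), Real.rpow_one]
  have hroot : (q ^ (ϰ + 1)) ^ (1 / (1 + (ϰ : ℝ))) = q := by
    rw [← Real.rpow_natCast, ← Real.rpow_mul hq]
    push_cast
    rw [add_comm (ϰ : ℝ) 1, one_div, mul_inv_cancel₀ (by positivity), Real.rpow_one]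
  rw [hroot]
  split_ifs with h
  · rcases hS.eq_or_lt with rfl | hS
    -- Here both centres are on the degenerate set; the numerator vanishes, so the quotient is `0`
    -- whatever its denominator.
    · obtain rfl : q = 0 := le_antisymm h hq
      simp only [ne_eq, Nat.add_eq_zero_iff, one_ne_zero, and_false, not_false_eq_true, zero_pow,
        zero_div, hr, true_iff]
      positivity
    · rw [div_lt_iff₀ (by positivity)]
      constructor
      · intro h1
        exact h1.trans_le (by gcongr; exact le_max_left _ _)
      · intro h1
        rcases le_or_gt r S with h2 | h2
        · rwa [max_eq_left h2] at h1
        · calc q ^ (ϰ + 1) = q ^ ϰ * q := pow_succ _ _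
            _ ≤ S ^ ϰ * S := by gcongr
            _ < r * S ^ ϰ := by rw [mul_comm]; gcongr
  · push Not at h
    constructor
    · intro h1
      rw [max_eq_right (h.trans h1).le, ← pow_succ']
      exact pow_lt_pow_left₀ h1 hq (by omega)
    · intro h1
      by_contra! h2
      have : r * max S r ^ ϰ ≤ q ^ (ϰ + 1) := by
        rw [pow_succ, mul_comm]
        gcongr
        exact max_le h.le h2
      linarith

lemma vertical_nonneg (ϰ : ℕ) {δ S : ℝ} (hδ : 0 ≤ δ) (hS : 0 ≤ S) :
    0 ≤ if δ ^ (1 / (1 + (ϰ : ℝ))) ≤ S then δ / S ^ ϰ else δ ^ (1 / (1 + (ϰ : ℝ))) := by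
  split_ifs <;> positivity

lemma norm_fst_sub_le_dist (ϰ : ℕ) (x y : Space n₁ n₂) : ‖x.1 - y.1‖ ≤ dist ϰ x y :=
  le_add_of_nonneg_right (vertical_nonneg ϰ (norm_nonneg _) (by positivity))

lemma dist_nonneg (ϰ : ℕ) (x y : Space n₁ n₂) : 0 ≤ dist ϰ x y :=
  (norm_nonneg _).trans (norm_fst_sub_le_dist ϰ x y)

lemma dist_comm (ϰ : ℕ) (x y : Space n₁ n₂) : dist ϰ x y = dist ϰ y x := by
  simp only [dist, norm_sub_rev x.1 y.1, norm_sub_rev x.2 y.2, add_comm ‖x.1‖ ‖y.1‖]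

lemma dist_self (ϰ : ℕ) (x : Space n₁ n₂) : dist ϰ x x = 0 := by
  have : 1 + (ϰ : ℝ) ≠ 0 := by positivity
  have h : (if (0 : ℝ) ^ (1 / (1 + (ϰ : ℝ))) ≤ ‖x.1‖ + ‖x.1‖ then 0 / (‖x.1‖ + ‖x.1‖) ^ ϰ else
    (0 : ℝ) ^ (1 / (1 + (ϰ : ℝ)))) = 0 := by
    rw [Real.zero_rpow (by positivity)]
    simp
  simp only [dist, sub_self, norm_zero, h, add_zero]

lemma mem_ball_self (ϰ : ℕ) (c : Space n₁ n₂) {r : ℝ} (hr : 0 < r) : c ∈ ball ϰ c r := by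
  simpa only [ball, Set.mem_ofPred_eq, dist_self] using hr

/-- With `dist_lt_of_norm_le` this says that balls are comparable to boxes of horizontal size `r`
and vertical size `r (r + |x'|)^ϰ`. The factor `2^ϰ` comes from `|y'| ≤ |x'| + r`. -/
lemma norm_snd_sub_lt_of_dist_lt {ϰ : ℕ} {x y : Space n₁ n₂} {r : ℝ} (h : dist ϰ x y < r) :
    ‖x.2 - y.2‖ < 2 ^ ϰ * (r * (r + ‖x.1‖) ^ ϰ) := by
  have hr : 0 < r := (dist_nonneg ϰ x y).trans_lt h
  have h1 : ‖x.1 - y.1‖ < r := (norm_fst_sub_le_dist ϰ x y).trans_lt h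
  have h2 := (vertical_lt_iff ϰ (norm_nonneg (x.2 - y.2))
    (by positivity : 0 ≤ ‖x.1‖ + ‖y.1‖) hr).1
    ((le_add_of_nonneg_left (norm_nonneg (x.1 - y.1))).trans_lt h)
  have h3 : ‖y.1‖ ≤ ‖x.1‖ + r := by
    have := norm_sub_norm_le y.1 x.1
    rw [norm_sub_rev] at this
    linarith
  have h4 : max (‖x.1‖ + ‖y.1‖) r ≤ 2 * (r + ‖x.1‖) :=
    max_le (by linarith [norm_nonneg x.1]) (by linarith [norm_nonneg x.1])
  calc ‖x.2 - y.2‖ < r * max (‖x.1‖ + ‖y.1‖) r ^ ϰ := h2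
    _ ≤ r * (2 * (r + ‖x.1‖)) ^ ϰ := by gcongr
    _ = _ := by rw [mul_pow]; ring

lemma dist_lt_of_norm_le {ϰ : ℕ} {x y : Space n₁ n₂} {r a b : ℝ} (hr : 0 < r)
    (hb : 1 ≤ b) (h1 : ‖x.1 - y.1‖ ≤ a * r) (h2 : ‖x.2 - y.2‖ ≤ b * (r * (r + ‖x.1‖) ^ ϰ)) :
    dist ϰ x y < (a + 2 ^ (ϰ + 1) * b) * r := by
  have hB : 2 ≤ 2 ^ (ϰ + 1) * b := by
    have : (1 : ℝ) ≤ 2 ^ ϰ := one_le_pow₀ (by norm_num)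
    rw [pow_succ]
    nlinarith
  rw [add_mul]
  refine add_lt_add_of_le_of_lt h1 ?_
  rw [vertical_lt_iff ϰ (norm_nonneg _) (by positivity) (by positivity)]
  -- Either `|x'|` or `r` is at least half of `r + |x'|`, and both are controlled by the maximum in
  -- `vertical_lt_iff`.
  have h3 : (r + ‖x.1‖) / 2 ≤ max (‖x.1‖ + ‖y.1‖) (2 ^ (ϰ + 1) * b * r) := by
    rcases le_total r ‖x.1‖ with h | h
    · exact le_max_of_le_left (by linarith [norm_nonneg y.1])
    · exact le_max_of_le_right (by nlinarith)
  calc ‖x.2 - y.2‖ ≤ b * (r * (r + ‖x.1‖) ^ ϰ) := h2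
    _ < 2 * (b * (r * (r + ‖x.1‖) ^ ϰ)) := by
      have : 0 < b * (r * (r + ‖x.1‖) ^ ϰ) := by positivity
      linarith
    _ = 2 ^ (ϰ + 1) * b * r * ((r + ‖x.1‖) / 2) ^ ϰ := by
      rw [div_pow, pow_succ]; field_simp
    _ ≤ _ := by gcongr

lemma measurable_dist_right (ϰ : ℕ) (c : Space n₁ n₂) : Measurable (dist ϰ c) := by
  unfold dist
  refine Measurable.add (by fun_prop) (Measurable.ite ?_ (by fun_prop) (by fun_prop))
  exact measurableSet_le (by fun_prop) (by fun_prop)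

lemma measurableSet_ball (ϰ : ℕ) (c : Space n₁ n₂) (r : ℝ) : MeasurableSet (ball ϰ c r) :=
  measurable_dist_right ϰ c measurableSet_Iio

/-- The size `r ^ n₁ (r (r + |c'|) ^ ϰ) ^ n₂` of the ball `B(c, r)`, up to constants. -/
noncomputable def boxVol (ϰ : ℕ) (c : Space n₁ n₂) (r : ℝ) : ℝ := r ^ n₁ * (r * (r + ‖c.1‖) ^ ϰ) ^ n₂

lemma boxVol_pos (ϰ : ℕ) (c : Space n₁ n₂) {r : ℝ} (hr : 0 < r) : 0 < boxVol ϰ c r := by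
  unfold boxVol; positivity

lemma boxVol_mono (ϰ : ℕ) (c : Space n₁ n₂) {r R : ℝ} (hr : 0 < r) (h : r ≤ R) :
    boxVol ϰ c r ≤ boxVol ϰ c R := by
  have := hr.trans_le h
  unfold boxVol; gcongr

/-- This is doubling with the homogeneous dimension as exponent; the sharp exponent is what makes
`R₀ > Q` sufficient later. -/
lemma boxVol_mul_le (ϰ : ℕ) (c : Space n₁ n₂) {r a : ℝ} (hr : 0 < r) (ha : 1 ≤ a) :
    boxVol ϰ c (a * r) ≤ a ^ (n₁ + (1 + ϰ) * n₂) * boxVol ϰ c r := by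
  have : a * r + ‖c.1‖ ≤ a * (r + ‖c.1‖) := by nlinarith [norm_nonneg c.1]
  calc boxVol ϰ c (a * r) ≤ (a * r) ^ n₁ * (a * r * (a * (r + ‖c.1‖)) ^ ϰ) ^ n₂ := by
        unfold boxVol; gcongr
    _ = _ := by unfold boxVol; rw [mul_pow a (r + _)]; ring

/-- The box volume sees its centre only through `|c'|`, so only the horizontal displacement matters.
-/
lemma boxVol_le_of_norm_sub_le (ϰ : ℕ) {c y : Space n₁ n₂} {r A : ℝ} (hr : 0 < r) (hA : 0 ≤ A)
    (h : ‖c.1 - y.1‖ ≤ A * r) : boxVol ϰ c r ≤ (1 + A) ^ (ϰ * n₂) * boxVol ϰ y r := by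
  have : r + ‖c.1‖ ≤ (1 + A) * (r + ‖y.1‖) := by
    have := norm_sub_norm_le c.1 y.1
    nlinarith [norm_nonneg y.1]
  calc boxVol ϰ c r ≤ r ^ n₁ * (r * ((1 + A) * (r + ‖y.1‖)) ^ ϰ) ^ n₂ := by
        unfold boxVol; gcongr
    _ = _ := by unfold boxVol; rw [mul_pow (1 + A)]; ring

lemma volume_prod_ball (c : Space n₁ n₂) {a b : ℝ} (ha : 0 < a) (hb : 0 < b) :
    volume (Metric.ball c.1 a ×ˢ Metric.ball c.2 b) =
      ENNReal.ofReal (a ^ n₁ * b ^ n₂) *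
        volume (Metric.ball (0 : EuclideanSpace ℝ (Fin n₁)) 1 ×ˢ
          Metric.ball (0 : EuclideanSpace ℝ (Fin n₂)) 1) := by
  rw [Measure.volume_eq_prod, Measure.prod_prod, Measure.prod_prod,
    Measure.addHaar_ball_of_pos _ _ ha, Measure.addHaar_ball_of_pos _ _ hb, finrank_euclideanSpace_fin,
    finrank_euclideanSpace_fin, ENNReal.ofReal_mul (by positivity)]
  ring

/-- Two-sided volume bound for balls. -/
lemma exists_volume_ball_bounds (n₁ n₂ ϰ : ℕ) :
    ∃ a b : ℝ, 0 < a ∧ 0 < b ∧ ∀ (c : Space n₁ n₂) (r : ℝ), 0 < r →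
      ENNReal.ofReal (a * boxVol ϰ c r) ≤ volume (ball ϰ c r) ∧
      volume (ball ϰ c r) ≤ ENNReal.ofReal (b * boxVol ϰ c r) := by
  set κ := volume (Metric.ball (0 : EuclideanSpace ℝ (Fin n₁)) 1 ×ˢ
          Metric.ball (0 : EuclideanSpace ℝ (Fin n₂)) 1) with hκ
  have hκ0 : κ ≠ 0 := by
    rw [hκ, Measure.volume_eq_prod, Measure.prod_prod]
    exact mul_ne_zero (Metric.measure_ball_pos _ _ one_pos).ne'
      (Metric.measure_ball_pos _ _ one_pos).ne'
  have hκt : κ ≠ ⊤ := by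
    rw [hκ, Measure.volume_eq_prod, Measure.prod_prod]
    exact ENNReal.mul_ne_top measure_ball_lt_top.ne measure_ball_lt_top.ne
  have hκp : 0 < κ.toReal := ENNReal.toReal_pos hκ0 hκt
  have hκr : κ = ENNReal.ofReal κ.toReal := (ENNReal.ofReal_toReal hκt).symm
  set D : ℝ := 1 + 2 ^ (ϰ + 1) * 1 with hD
  have hD1 : 1 ≤ D := le_add_of_nonneg_right (by positivity)
  refine ⟨κ.toReal / D ^ (n₁ + (1 + ϰ) * n₂), κ.toReal * 2 ^ (ϰ * n₂), by positivity,
    by positivity, fun c r hr => ⟨?_, ?_⟩⟩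
  · have hrD : 0 < r / D := by positivity
    have hsub : Metric.ball c.1 (r / D) ×ˢ
        Metric.ball c.2 (r / D * (r / D + ‖c.1‖) ^ ϰ) ⊆ ball ϰ c r := by
      rintro y ⟨hy1, hy2⟩
      rw [Metric.mem_ball', dist_eq_norm] at hy1 hy2
      have := dist_lt_of_norm_le (a := 1) (b := 1) hrD le_rfl (by linarith) (by linarith)
      rwa [← hD, mul_div_cancel₀ _ (by positivity)] at this
    refine le_trans ?_ (measure_mono hsub)
    rw [volume_prod_ball _ hrD (by positivity), ← hκ, hκr,
      ← ENNReal.ofReal_mul (by positivity)]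
    refine ENNReal.ofReal_le_ofReal ?_
    have := boxVol_mul_le ϰ c hrD hD1
    rw [mul_div_cancel₀ _ (by positivity : D ≠ 0)] at this
    rw [ENNReal.toReal_ofReal hκp.le, div_mul_eq_mul_div, div_le_iff₀ (by positivity)]
    calc κ.toReal * boxVol ϰ c r
        ≤ κ.toReal * (D ^ (n₁ + (1 + ϰ) * n₂) * boxVol ϰ c (r / D)) := by gcongr
      _ = _ := by rw [boxVol]; ring
  · have hsub : ball ϰ c r ⊆
        Metric.ball c.1 r ×ˢ Metric.ball c.2 (2 ^ ϰ * (r * (r + ‖c.1‖) ^ ϰ)) := by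
      intro y hy
      refine ⟨?_, ?_⟩
      · rw [Metric.mem_ball', dist_eq_norm]
        exact (norm_fst_sub_le_dist ϰ c y).trans_lt hy
      · rw [Metric.mem_ball', dist_eq_norm]
        exact norm_snd_sub_lt_of_dist_lt hy
    refine (measure_mono hsub).trans ?_
    rw [volume_prod_ball _ hr (by positivity), ← hκ, hκr,
      ← ENNReal.ofReal_mul (by positivity)]
    refine ENNReal.ofReal_le_ofReal (le_of_eq ?_)
    rw [ENNReal.toReal_ofReal hκp.le, boxVol]
    ring

/-! ### The maximal function -/

lemma lintegral_ball_le_maximal (n₁ n₂ ϰ : ℕ) :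
    ∃ b : ℝ, 0 < b ∧ ∀ (f : Space n₁ n₂ → ℂ) (c x : Space n₁ n₂) (r : ℝ), x ∈ ball ϰ c r →
      ∫⁻ y in ball ϰ c r, ‖f y‖ₑ ≤ ENNReal.ofReal (b * boxVol ϰ c r) * maximal ϰ f x := by
  obtain ⟨a, b, ha, hb, h⟩ := exists_volume_ball_bounds n₁ n₂ ϰ
  refine ⟨b, hb, fun f c x r hx => ?_⟩
  have hr : 0 < r := (dist_nonneg ϰ c x).trans_lt hx
  obtain ⟨h1, h2⟩ := h c r hr
  have hp : volume (ball ϰ c r) ≠ 0 := by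
    refine (lt_of_lt_of_le ?_ h1).ne'
    have := boxVol_pos ϰ c hr
    rw [ENNReal.ofReal_pos]; positivity
  have ht : volume (ball ϰ c r) ≠ ⊤ := (h2.trans_lt ENNReal.ofReal_lt_top).ne
  have hM : (volume (ball ϰ c r))⁻¹ * ∫⁻ y in ball ϰ c r, ‖f y‖ₑ ≤ maximal ϰ f x :=
    le_iSup_of_le c (le_iSup_of_le r (le_iSup_of_le hr (le_iSup_of_le hx le_rfl)))
  calc ∫⁻ y in ball ϰ c r, ‖f y‖ₑ
      = volume (ball ϰ c r) * ((volume (ball ϰ c r))⁻¹ * ∫⁻ y in ball ϰ c r, ‖f y‖ₑ) := by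
        rw [← mul_assoc, ENNReal.mul_inv_cancel hp ht]; exact (one_mul _).symm
    _ ≤ _ := by gcongr

lemma maximal_mono (ϰ : ℕ) {f g : Space n₁ n₂ → ℂ} (h : ∀ᵐ x, ‖f x‖ₑ ≤ ‖g x‖ₑ)
    (x : Space n₁ n₂) : maximal ϰ f x ≤ maximal ϰ g x := by
  unfold maximal
  refine iSup_mono fun c => iSup_mono fun r => iSup_mono fun _ => iSup_mono fun _ => ?_
  gcongr _ * ?_
  exact lintegral_mono_ae (ae_restrict_of_ae h)

/-- The maximal function is of weak type `(1, 1)`. -/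
lemma exists_volume_lt_maximal_le {n₁ n₂ ϰ : ℕ} (hn₁ : 1 ≤ n₁) {C₀ : ℝ}
    (hC₀ : 1 < C₀) (hquasi : ∀ x y z : Space n₁ n₂,
      dist ϰ x y ≤ C₀ * (dist ϰ x z + dist ϰ z y)) :
    ∃ C : ℝ≥0, ∀ f : Space n₁ n₂ → ℂ, ∫⁻ y, ‖f y‖ₑ ≠ ⊤ → ∀ t : ℝ≥0∞, 0 < t → t ≠ ⊤ →
      volume {x | t < maximal ϰ f x} ≤ C * (∫⁻ y, ‖f y‖ₑ) / t := by
  obtain ⟨a, b, ha, hb, hvol⟩ := exists_volume_ball_bounds n₁ n₂ ϰ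
  set Q := n₁ + (1 + ϰ) * n₂ with hQ
  -- The covering lemma selects balls up to a factor `3` in the radius. A ball of radius at most
  -- `3ρ` meeting a selected ball of radius `ρ` lies, by two quasi-triangle inequalities, within `C₀
  -- (1 + 6 C₀) ρ` of its centre.
  set E : ℝ := C₀ * (2 + 2 * C₀ * 3) with hE
  have hE1 : 1 ≤ E := by nlinarith
  have hvolpos : ∀ (c : Space n₁ n₂) (r : ℝ), 0 < r → volume (ball ϰ c r) ≠ 0 := by
    intro c r hr
    refine (lt_of_lt_of_le ?_ (hvol c r hr).1).ne'
    have := boxVol_pos ϰ c hr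
    rw [ENNReal.ofReal_pos]; positivity
  have hvoltop : ∀ (c : Space n₁ n₂) (r : ℝ), 0 < r → volume (ball ϰ c r) ≠ ⊤ :=
    fun c r hr => ((hvol c r hr).2.trans_lt ENNReal.ofReal_lt_top).ne
  have hdbl : ∀ (c : Space n₁ n₂) (r : ℝ), 0 < r → volume (ball ϰ c (E * r)) ≤
      ENNReal.ofReal (b * E ^ Q / a) * volume (ball ϰ c r) := by
    intro c r hr
    calc volume (ball ϰ c (E * r)) ≤ ENNReal.ofReal (b * boxVol ϰ c (E * r)) :=
          (hvol c _ (by positivity)).2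
      _ ≤ ENNReal.ofReal (b * E ^ Q / a * (a * boxVol ϰ c r)) := by
          refine ENNReal.ofReal_le_ofReal ?_
          calc b * boxVol ϰ c (E * r) ≤ b * (E ^ Q * boxVol ϰ c r) := by
                gcongr; exact boxVol_mul_le ϰ c hr hE1
            _ = _ := by field_simp
      _ = ENNReal.ofReal (b * E ^ Q / a) * ENNReal.ofReal (a * boxVol ϰ c r) :=
          ENNReal.ofReal_mul (by positivity)
      _ ≤ _ := by gcongr; exact (hvol c r hr).1
  refine ⟨(b * E ^ Q / a).toNNReal, fun f hf t ht ht' => ?_⟩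
  set I := ∫⁻ y, ‖f y‖ₑ with hI
  let F : Set (Space n₁ n₂ × ℝ) :=
    {p | 0 < p.2 ∧ t * volume (ball ϰ p.1 p.2) < ∫⁻ y in ball ϰ p.1 p.2, ‖f y‖ₑ}
  -- Balls with large averages have volume at most `‖f‖₁ / t`, and for `r ≥ 1` the volume is at
  -- least `a r` since `n₁ ≥ 1`; hence the radii are bounded, as Vitali's lemma requires.
  have hFbd : ∃ R : ℝ, ∀ p ∈ F, p.2 ≤ R := by
    set M := (I / t).toReal with hM
    have hIt : I / t ≠ ⊤ := ENNReal.div_ne_top hf ht.ne'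
    refine ⟨max 1 (M / a), fun p hp => ?_⟩
    rcases le_total p.2 1 with h1 | h1
    · exact le_max_of_le_left h1
    refine le_max_of_le_right ?_
    have h2 : volume (ball ϰ p.1 p.2) ≤ I / t := by
      rw [ENNReal.le_div_iff_mul_le (Or.inl ht.ne') (Or.inl ht'), mul_comm]
      exact hp.2.le.trans (setLIntegral_le_lintegral _ _)
    have h3 := (hvol p.1 p.2 hp.1).1.trans h2
    rw [ENNReal.ofReal_le_iff_le_toReal hIt, ← hM] at h3
    rw [le_div_iff₀ ha, mul_comm]
    refine le_trans ?_ h3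
    have h4 : 1 ≤ p.2 * (p.2 + ‖p.1.1‖) ^ ϰ :=
      one_le_mul_of_one_le_of_one_le h1 (one_le_pow₀ (by linarith [norm_nonneg p.1.1]))
    have h5 : p.2 ≤ boxVol ϰ p.1 p.2 := by
      calc p.2 = p.2 * 1 := (mul_one _).symm
        _ ≤ p.2 ^ n₁ * (p.2 * (p.2 + ‖p.1.1‖) ^ ϰ) ^ n₂ := by
          gcongr
          · exact le_self_pow₀ h1 (by omega)
          · exact one_le_pow₀ h4
    gcongr
  obtain ⟨R, hR⟩ := hFbd
  obtain ⟨u, huF, hdisj, hcov⟩ := Vitali.exists_disjoint_subfamily_covering_enlargement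
    (fun p : Space n₁ n₂ × ℝ => ball ϰ p.1 p.2) F Prod.snd 3 (by norm_num)
    (fun p hp => hp.1.le) R hR (fun p hp => ⟨p.1, mem_ball_self ϰ _ hp.1⟩)
  have hucount : u.Countable := by
    have h1 := Measure.countable_meas_pos_of_disjoint_iUnion (μ := volume)
      (As := fun p : u => ball ϰ p.1.1 p.1.2) (fun p => measurableSet_ball ϰ _ _)
      (fun p q hpq => hdisj p.2 q.2 (fun h => hpq (Subtype.ext h)))
    have h2 : {p : u | 0 < volume (ball ϰ p.1.1 p.1.2)} = Set.univ :=
      Set.eq_univ_of_forall fun p => pos_iff_ne_zero.2 (hvolpos _ _ (huF p.2).1)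
    rw [h2] at h1
    exact Set.countable_coe_iff.1 (Set.countable_univ_iff.1 h1)
  have hsub : {x | t < maximal ϰ f x} ⊆ ⋃ p ∈ u, ball ϰ p.1 (E * p.2) := by
    intro x hx
    simp only [Set.mem_ofPred_eq, maximal, lt_iSup_iff] at hx
    obtain ⟨c, r, hr, hxc, h⟩ := hx
    have hF : (c, r) ∈ F := by
      refine ⟨hr, ?_⟩
      rw [← ENNReal.div_eq_inv_mul] at h
      calc t * volume (ball ϰ c r) = volume (ball ϰ c r) * t := mul_comm _ _
        _ < volume (ball ϰ c r) * ((∫⁻ y in ball ϰ c r, ‖f y‖ₑ) / volume (ball ϰ c r)) :=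
          (ENNReal.mul_lt_mul_iff_right (hvolpos c r hr) (hvoltop c r hr)).2 h
        _ = _ := ENNReal.mul_div_cancel (hvolpos c r hr) (hvoltop c r hr)
    obtain ⟨p, hp, ⟨z, hz1, hz2⟩, hle⟩ := hcov _ hF
    refine Set.mem_biUnion hp ?_
    simp only [ball, Set.mem_ofPred_eq] at hz1 hz2 hxc hle ⊢
    have e1 := hquasi p.1 x z
    have e2 := hquasi z x c
    rw [dist_comm ϰ z c] at e2
    have hp0 := (huF hp).1
    have e3 : dist ϰ z x ≤ C₀ * (2 * (3 * p.2)) := e2.trans (by gcongr; linarith only [hz1, hxc, hle])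
    calc dist ϰ p.1 x ≤ C₀ * (dist ϰ p.1 z + dist ϰ z x) := e1
      _ < E * p.2 := by
        rw [hE, mul_assoc]
        gcongr
        linarith only [hz2, hp0, e3]
  have hu' : Countable u := hucount
  calc volume {x | t < maximal ϰ f x} ≤ volume (⋃ p ∈ u, ball ϰ p.1 (E * p.2)) :=
        measure_mono hsub
    _ ≤ ∑' p : u, volume (ball ϰ p.1.1 (E * p.1.2)) := measure_biUnion_le _ hucount _
    _ ≤ ∑' p : u, ENNReal.ofReal (b * E ^ Q / a) *
          ((∫⁻ y in ball ϰ p.1.1 p.1.2, ‖f y‖ₑ) / t) := by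
        refine ENNReal.tsum_le_tsum fun p => (hdbl _ _ (huF p.2).1).trans ?_
        gcongr _ * ?_
        rw [ENNReal.le_div_iff_mul_le (Or.inl ht.ne') (Or.inl ht'), mul_comm]
        exact (huF p.2).2.le
    _ = ENNReal.ofReal (b * E ^ Q / a) *
          ((∑' p : u, ∫⁻ y in ball ϰ p.1.1 p.1.2, ‖f y‖ₑ) / t) := by
        rw [ENNReal.tsum_mul_left]
        simp_rw [div_eq_mul_inv]
        rw [ENNReal.tsum_mul_right]
    _ ≤ ENNReal.ofReal (b * E ^ Q / a) * (I / t) := by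
        gcongr
        rw [← lintegral_biUnion hucount (fun p _ => measurableSet_ball ϰ _ _) hdisj]
        exact setLIntegral_le_lintegral _ _
    _ = _ := (mul_div_assoc _ _ _).symm

end Grushin

namespace Grushin

open Filter Topology

variable {n₁ n₂ : ℕ}

/-! ### Strong convergence of the dyadic spectral decomposition -/

lemma exists_mem_formDomain_formIncl_eq (V : Potential) (ϰ : ℕ) {φ : Space n₁ n₂ → ℂ}
    (hφ : ContDiff ℝ ∞ φ) (hc : HasCompactSupport φ) (f : L2 n₁ n₂) (hf : f =ᵐ[volume] φ) :
    f ∈ LinearMap.range (formIncl V ϰ n₁ n₂).toLinearMap := by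
  have hd : Continuous (fderiv ℝ φ) := hφ.continuous_fderiv (by simp)
  have hdc : HasCompactSupport (fderiv ℝ φ) := hc.fderiv ℝ
  have h1 : ∀ j, MemLp (partial₁ j φ) 2 (volume : Measure (Space n₁ n₂)) := fun j =>
    (Continuous.clm_apply hd continuous_const).memLp_of_hasCompactSupport
      (hdc.mono fun x hx h => hx (by simp [h]))
  have hV : Continuous fun x : Space n₁ n₂ => V.eval ϰ x.1 := by
    cases V <;> simp only [Potential.eval] <;> fun_prop
  have h2 : ∀ k, MemLp (fun x => (Real.sqrt (V.eval ϰ x.1) : ℂ) * partial₂ k φ x) 2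
      (volume : Measure (Space n₁ n₂)) := fun k => by
    refine Continuous.memLp_of_hasCompactSupport ?_
      (hdc.mono fun x hx h => hx (by simp [partial₂, h]))
    exact (Complex.continuous_ofReal.comp hV.sqrt).mul
      (Continuous.clm_apply hd continuous_const)
  let p : GraphSpace n₁ n₂ := WithLp.toLp 2 fun o => match o with
    | none => f
    | some (Sum.inl j) => (h1 j).toLp
    | some (Sum.inr k) => (h2 k).toLp
  have hp : p ∈ formDomain V ϰ n₁ n₂ := by
    refine Submodule.le_topologicalClosure _ (Submodule.subset_span ?_)
    exact ⟨φ, hφ, hc, hf, fun j => (h1 j).coeFn_toLp, fun k => (h2 k).coeFn_toLp⟩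
  exact ⟨⟨p, hp⟩, rfl⟩

lemma orthogonal_range_formIncl (V : Potential) (ϰ n₁ n₂ : ℕ) :
    (formIncl V ϰ n₁ n₂).rangeᗮ = ⊥ := by
  have hd := MeasureTheory.Lp.dense_hasCompactSupport_contDiff (E := Space n₁ n₂) (F := ℂ)
    (μ := volume) (p := 2) (by simp)
  rw [← Submodule.topologicalClosure_eq_top_iff, ← Submodule.dense_iff_topologicalClosure_eq_top]
  refine hd.mono ?_
  rintro f ⟨g, hfg, hg, hg'⟩
  exact exists_mem_formDomain_formIncl_eq V ϰ hg' hg f hfg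

/-- The resolvent is `ι ι†`, whose kernel is that of `ι†`, the orthogonal complement of the form
domain. The latter is zero because test functions are dense in `L²`. -/
lemma orthogonal_range_resolvent (V : Potential) (ϰ n₁ n₂ : ℕ) :
    (resolvent V ϰ n₁ n₂).rangeᗮ = ⊥ := by
  rw [ContinuousLinearMap.orthogonal_range]
  have : ContinuousLinearMap.adjoint (resolvent V ϰ n₁ n₂) = resolvent V ϰ n₁ n₂ := by
    rw [resolvent, ContinuousLinearMap.adjoint_comp, ContinuousLinearMap.adjoint_adjoint]
  rw [this, resolvent, ContinuousLinearMap.ker_self_comp_adjoint,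
    ← ContinuousLinearMap.orthogonal_range, orthogonal_range_formIncl]

lemma isPositive_resolvent (V : Potential) (ϰ n₁ n₂ : ℕ) :
    (resolvent V ϰ n₁ n₂).IsPositive :=
  ContinuousLinearMap.isPositive_self_comp_adjoint _

lemma spectralSubspace_mono {H : Type*} [NormedAddCommGroup H] [InnerProductSpace ℂ H]
    [CompleteSpace H] (A : H →L[ℂ] H) {U U' : Set ℝ} (h : U ⊆ U') :
    spectralSubspace A U ≤ spectralSubspace A U' :=
  Submodule.topologicalClosure_mono
    (biSup_mono fun _ hg => ⟨hg.1, fun t ht => hg.2 t fun ht' => ht (h ht')⟩)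

/-- The truncations `(A - ε)₊` have range in the spectral subspace of `(ε, ∞)` and differ from `A`
by at most `ε` in norm, the spectrum of `A` being nonnegative. -/
lemma range_le_closure_iSup_spectralSubspace {H : Type*} [NormedAddCommGroup H]
    [InnerProductSpace ℂ H] [CompleteSpace H] {A : H →L[ℂ] H} (hA : A.IsPositive)
    {ε : ℕ → ℝ} (hε : ∀ n, 0 ≤ ε n) (hlim : Tendsto ε atTop (𝓝 0)) :
    A.range ≤ (⨆ n, spectralSubspace A (Set.Ioi (ε n))).topologicalClosure := by
  rintro _ ⟨h, rfl⟩
  have hA0 : 0 ≤ A := (ContinuousLinearMap.nonneg_iff_isPositive A).2 hA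
  have hsa : IsSelfAdjoint A := hA.isSelfAdjoint
  have hnorm : ∀ n, ‖cfc (fun t : ℝ => max (t - ε n) 0) A - A‖ ≤ ε n := by
    intro n
    have : cfc (fun t : ℝ => max (t - ε n) 0) A - A = cfc (fun t : ℝ => max (t - ε n) 0 - t) A := by
      rw [cfc_sub _ _ A (by fun_prop) (by fun_prop), cfc_id' ℝ A]
    rw [this]
    refine norm_cfc_le (hε n) fun t ht => ?_
    have ht0 : 0 ≤ t := spectrum_nonneg_of_nonneg hA0 ht
    have := hε n
    rw [Real.norm_eq_abs, abs_le]
    rcases le_total t (ε n) with h1 | h1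
    · rw [max_eq_right (by linarith)]; constructor <;> linarith
    · rw [max_eq_left (by linarith)]; constructor <;> linarith
  have hconv : Tendsto (fun n => cfc (fun t : ℝ => max (t - ε n) 0) A h) atTop (𝓝 (A h)) := by
    have h1 : Tendsto (fun n => cfc (fun t : ℝ => max (t - ε n) 0) A) atTop (𝓝 A) :=
      tendsto_iff_norm_sub_tendsto_zero.2
        (squeeze_zero (fun _ => norm_nonneg _) hnorm hlim)
    exact ((ContinuousLinearMap.apply ℂ H h).continuous.tendsto A).comp h1
  refine mem_closure_of_tendsto hconv (Eventually.of_forall fun n => ?_)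
  refine (le_iSup (fun n => spectralSubspace A (Set.Ioi (ε n))) n) ?_
  refine Submodule.le_topologicalClosure _ ?_
  refine Submodule.mem_iSup_of_mem (fun t : ℝ => max (t - ε n) 0) ?_
  refine Submodule.mem_iSup_of_mem ⟨by fun_prop, fun t ht => ?_⟩ ⟨h, rfl⟩
  rw [Set.mem_Ioi, not_lt] at ht
  exact max_eq_right (by linarith)

/-- The spectral subspaces increase with `J`, and their union is dense because its closure contains
the dense range of the resolvent. -/
lemma tendsto_specProjBelow (V : Potential) (ϰ n₁ n₂ : ℕ) (h : L2 n₁ n₂) :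
    Tendsto (fun J : ℕ => specProjBelow V ϰ n₁ n₂ (2 ^ J) h) atTop (𝓝 h) := by
  refine Submodule.starProjection_tendsto_self
    (fun J : ℕ => spectralSubspace (resolvent V ϰ n₁ n₂) (Set.Ioi (1 + (2 : ℝ) ^ J)⁻¹))
    ?_ h ?_
  · intro i j hij
    refine spectralSubspace_mono _ (Set.Ioi_subset_Ioi ?_)
    gcongr
    norm_num
  · have hle := range_le_closure_iSup_spectralSubspace (isPositive_resolvent V ϰ n₁ n₂)
      (ε := fun J : ℕ => (1 + (2 : ℝ) ^ J)⁻¹) (fun J => by positivity)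
      (tendsto_inv_atTop_zero.comp (tendsto_atTop_add_const_left _ _
        (tendsto_pow_atTop_atTop_of_one_lt (by norm_num))))
    rw [top_le_iff, Submodule.topologicalClosure_eq_top_iff, eq_bot_iff,
      ← orthogonal_range_resolvent V ϰ n₁ n₂, ← Submodule.orthogonal_closure (⨆ t, _)]
    exact Submodule.orthogonal_le hle

lemma sum_chi (V : Potential) (ϰ n₁ n₂ J : ℕ) :
    ∑ j ∈ Finset.range (J + 1), chi V ϰ n₁ n₂ j = specProjBelow V ϰ n₁ n₂ (2 ^ J) := by
  induction J with
  | zero => simp [chi]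
  | succ J ih => rw [Finset.sum_range_succ, ih, chi]; abel

lemma tendsto_sum_comp_chi (V : Potential) (ϰ n₁ n₂ : ℕ) (T : L2 n₁ n₂ →L[ℂ] L2 n₁ n₂)
    (h : L2 n₁ n₂) :
    Tendsto (fun J : ℕ => ∑ j ∈ Finset.range (J + 1), T.comp (chi V ϰ n₁ n₂ j) h) atTop
      (𝓝 (T h)) := by
  have h1 := (T.continuous.tendsto h).comp (tendsto_specProjBelow V ϰ n₁ n₂ h)
  refine h1.congr fun J => ?_
  simp only [Function.comp_apply, ← sum_chi, ContinuousLinearMap.comp_apply,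
    _root_.sum_apply, map_sum]

/-- Along a subsequence the partial sums of `∑ⱼ T χⱼ(G) g` converge to `T g` almost everywhere. -/
lemma exists_subseq_tendsto_applyFun (V : Potential) (ϰ : ℕ) (T : L2 n₁ n₂ →L[ℂ] L2 n₁ n₂)
    {g : Space n₁ n₂ → ℂ} (hg : MemLp g 2 volume) :
    ∃ ns : ℕ → ℕ, ∀ᵐ x, Tendsto (fun i => ∑ j ∈ Finset.range (ns i + 1),
      applyFun (T.comp (chi V ϰ n₁ n₂ j)) g x) atTop (𝓝 (applyFun T g x)) := by
  obtain ⟨ns, -, hns⟩ := (tendstoInMeasure_of_tendsto_Lp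
    (tendsto_sum_comp_chi V ϰ n₁ n₂ T (hg.toLp g))).exists_seq_tendsto_ae
  refine ⟨ns, ?_⟩
  have hsum : ∀ᵐ x, ∀ J : ℕ,
      (∑ j ∈ Finset.range (J + 1), T.comp (chi V ϰ n₁ n₂ j) (hg.toLp g) : L2 n₁ n₂) x =
      ∑ j ∈ Finset.range (J + 1), (T.comp (chi V ϰ n₁ n₂ j) (hg.toLp g) : L2 n₁ n₂) x :=
    ae_all_iff.2 fun J => (Lp.coeFn_finsetSum _ _).mono fun x hx => by
      rw [hx, Finset.sum_apply]
  filter_upwards [hns, hsum] with x hx hx'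
  simp only [applyFun, dif_pos hg]
  exact hx.congr fun i => hx' _

end Grushin

namespace Grushin

open Filter Topology

variable {n₁ n₂ : ℕ}

/-! ### A mean value inequality for the gradient `X` -/

lemma gradNorm_nonneg (ϰ : ℕ) (φ : Space n₁ n₂ → ℂ) (x : Space n₁ n₂) : 0 ≤ gradNorm ϰ φ x :=
  Real.sqrt_nonneg _

lemma norm_partial₁_le_gradNorm (ϰ : ℕ) (φ : Space n₁ n₂ → ℂ) (x : Space n₁ n₂) (j : Fin n₁) :
    ‖partial₁ j φ x‖ ≤ gradNorm ϰ φ x := by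
  refine Real.le_sqrt_of_sq_le ?_
  refine le_add_of_le_of_nonneg ?_ (by positivity)
  exact Finset.single_le_sum (f := fun j => ‖partial₁ j φ x‖ ^ 2) (fun _ _ => by positivity)
    (Finset.mem_univ j)

lemma abs_pow_mul_norm_partial₂_le_gradNorm (ϰ : ℕ) (φ : Space n₁ n₂ → ℂ) (x : Space n₁ n₂)
    (i : Fin n₁) (k : Fin n₂) : |x.1 i| ^ ϰ * ‖partial₂ k φ x‖ ≤ gradNorm ϰ φ x := by
  refine Real.le_sqrt_of_sq_le ?_
  refine le_add_of_nonneg_of_le (by positivity) ?_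
  -- Among the fields `X_{α,k}` only the pure powers `(x'_i)^ϰ ∂_{x''_k}` are needed: some
  -- coordinate of `x'` is comparable to `|x'|`.
  have hα : (Pi.single i ϰ : Fin n₁ → ℕ) ∈
      Finset.piAntidiag (Finset.univ : Finset (Fin n₁)) ϰ := by
    simp [Finset.mem_piAntidiag]
  have hprod : (∏ l, x.1 l ^ (Pi.single i ϰ : Fin n₁ → ℕ) l) = x.1 i ^ ϰ := by
    rw [Finset.prod_eq_single i (fun l _ hl => by simp [Pi.single_eq_of_ne hl])
      (fun h => absurd (Finset.mem_univ i) h), Pi.single_eq_same]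
  refine le_trans ?_ (Finset.single_le_sum
    (f := fun α : Fin n₁ → ℕ => ∑ k, ‖((∏ i, x.1 i ^ α i : ℝ) : ℂ) * partial₂ k φ x‖ ^ 2)
    (fun _ _ => by positivity) hα)
  refine le_trans ?_ (Finset.single_le_sum
    (f := fun k => ‖((∏ l, x.1 l ^ (Pi.single i ϰ : Fin n₁ → ℕ) l : ℝ) : ℂ) *
      partial₂ k φ x‖ ^ 2) (fun _ _ => by positivity) (Finset.mem_univ k))
  rw [hprod, norm_mul, Complex.norm_real, Real.norm_eq_abs, abs_pow]

lemma norm_clm_apply_le_of_single_le {n : ℕ} (L : EuclideanSpace ℝ (Fin n) →ₗ[ℝ] ℂ) {M : ℝ}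
    (hL : ∀ j, ‖L (EuclideanSpace.single j 1)‖ ≤ M) (v : EuclideanSpace ℝ (Fin n)) :
    ‖L v‖ ≤ n * ‖v‖ * M := by
  have hv : v = ∑ j, v j • EuclideanSpace.single j (1 : ℝ) := by
    conv_lhs => rw [← (EuclideanSpace.basisFun (Fin n) ℝ).sum_repr v]
    simp
  conv_lhs => rw [hv, map_sum]
  calc ‖∑ j, L (v j • EuclideanSpace.single j (1 : ℝ))‖
      ≤ ∑ j, ‖L (v j • EuclideanSpace.single j (1 : ℝ))‖ := norm_sum_le _ _
    _ ≤ ∑ _j : Fin n, ‖v‖ * M := by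
        refine Finset.sum_le_sum fun j _ => ?_
        rw [map_smul, norm_smul]
        gcongr
        · exact PiLp.norm_apply_le v j
        · exact hL j
    _ = _ := by simp [mul_assoc]

lemma norm_fderiv_horizontal_le (ϰ : ℕ) (φ : Space n₁ n₂ → ℂ) (x : Space n₁ n₂)
    (v : EuclideanSpace ℝ (Fin n₁)) : ‖fderiv ℝ φ x (v, 0)‖ ≤ n₁ * ‖v‖ * gradNorm ϰ φ x :=
  norm_clm_apply_le_of_single_le
    ((fderiv ℝ φ x).toLinearMap ∘ₗ LinearMap.inl ℝ _ _) (norm_partial₁_le_gradNorm ϰ φ x) v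

lemma norm_le_card_mul_abs_apply (hn₁ : 1 ≤ n₁) (x : EuclideanSpace ℝ (Fin n₁)) :
    ∃ i, ‖x‖ ≤ n₁ * |x i| := by
  have : NeZero n₁ := ⟨by omega⟩
  obtain ⟨i, -, hi⟩ := Finset.exists_max_image (Finset.univ : Finset (Fin n₁)) (fun i => |x i|)
    Finset.univ_nonempty
  refine ⟨i, ?_⟩
  rw [EuclideanSpace.norm_eq]
  refine Real.sqrt_le_iff.2 ⟨by positivity, ?_⟩
  have h1 : (1 : ℝ) ≤ n₁ := by exact_mod_cast hn₁
  calc ∑ j, ‖x j‖ ^ 2 ≤ ∑ _j : Fin n₁, |x i| ^ 2 := by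
        refine Finset.sum_le_sum fun j hj => ?_
        rw [Real.norm_eq_abs]
        exact pow_le_pow_left₀ (abs_nonneg _) (hi j hj) 2
    _ = n₁ * |x i| ^ 2 := by simp
    _ ≤ n₁ ^ 2 * |x i| ^ 2 := by gcongr; nlinarith
    _ = _ := by ring

lemma norm_pow_mul_norm_fderiv_vertical_le (hn₁ : 1 ≤ n₁) (ϰ : ℕ) (φ : Space n₁ n₂ → ℂ)
    (x : Space n₁ n₂) (v : EuclideanSpace ℝ (Fin n₂)) :
    ‖x.1‖ ^ ϰ * ‖fderiv ℝ φ x (0, v)‖ ≤ n₁ ^ ϰ * n₂ * ‖v‖ * gradNorm ϰ φ x := by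
  obtain ⟨i, hi⟩ := norm_le_card_mul_abs_apply hn₁ x.1
  have h := norm_clm_apply_le_of_single_le (M := gradNorm ϰ φ x)
    ((|x.1 i| ^ ϰ) • ((fderiv ℝ φ x).toLinearMap ∘ₗ LinearMap.inr ℝ _ _)) (fun k => by
      rw [LinearMap.smul_apply, norm_smul, Real.norm_eq_abs, abs_pow, abs_abs]
      exact abs_pow_mul_norm_partial₂_le_gradNorm ϰ φ x i k) v
  rw [LinearMap.smul_apply, norm_smul, Real.norm_eq_abs, abs_pow, abs_abs] at h
  change |x.1 i| ^ ϰ * ‖fderiv ℝ φ x (0, v)‖ ≤ _ at h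
  calc ‖x.1‖ ^ ϰ * ‖fderiv ℝ φ x (0, v)‖ ≤ (n₁ * |x.1 i|) ^ ϰ * ‖fderiv ℝ φ x (0, v)‖ := by gcongr
    _ = n₁ ^ ϰ * (|x.1 i| ^ ϰ * ‖fderiv ℝ φ x (0, v)‖) := by ring
    _ ≤ n₁ ^ ϰ * (n₂ * ‖v‖ * gradNorm ϰ φ x) := by gcongr
    _ = _ := by ring

lemma norm_sub_le_of_norm_fderiv_segment_le {φ : Space n₁ n₂ → ℂ} (hφ : Differentiable ℝ φ)
    {a v : Space n₁ n₂} {M : ℝ}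
    (h : ∀ t ∈ Set.Icc (0 : ℝ) 1, ‖fderiv ℝ φ (a + t • v) v‖ ≤ M) : ‖φ (a + v) - φ a‖ ≤ M := by
  have hd : ∀ t : ℝ, HasDerivAt (fun t : ℝ => φ (a + t • v)) (fderiv ℝ φ (a + t • v) v) t := by
    intro t
    have h1 : HasDerivAt (fun t : ℝ => a + t • v) v t := by
      simpa using ((hasDerivAt_id t).smul_const v).const_add a
    exact (hφ (a + t • v)).hasFDerivAt.comp_hasDerivAt t h1
  have := norm_image_sub_le_of_norm_deriv_le_segment_01' (C := M)
    (fun t _ => (hd t).hasDerivWithinAt) (fun t ht => h t (Set.Ico_subset_Icc_self ht))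
  simpa using this

lemma norm_add_smul_sub_sub_le {E : Type*} [NormedAddCommGroup E] [NormedSpace ℝ E] {a b c : E}
    {R t : ℝ} (ha : ‖c - a‖ ≤ R) (hb : ‖c - b‖ ≤ R) (ht : t ∈ Set.Icc (0 : ℝ) 1) :
    ‖c - (a + t • (b - a))‖ ≤ R := by
  have : c - (a + t • (b - a)) = (1 - t) • (c - a) + t • (c - b) := by module
  rw [this]
  refine (norm_add_le _ _).trans ?_
  rw [norm_smul, norm_smul, Real.norm_of_nonneg ht.1, Real.norm_of_nonneg (sub_nonneg.2 ht.2)]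
  nlinarith [ht.1, ht.2]

/-- Join `y` to `z` by a horizontal segment to `(p, y'')`, a vertical one to `(p, z'')` and a
horizontal one to `z`. If `|p|` is comparable to `r + |c'|`, then `|p|^ϰ` compensates the vertical
length `r (r + |c'|)^ϰ`, so each segment costs a multiple of `r M`. -/
lemma exists_norm_sub_le_of_gradNorm_le {n₁ : ℕ} (hn₁ : 1 ≤ n₁) (n₂ ϰ : ℕ) :
    ∃ A : ℝ, 1 ≤ A ∧ ∀ φ : Space n₁ n₂ → ℂ, Differentiable ℝ φ → ∀ (c : Space n₁ n₂) (r M : ℝ),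
      (∀ u ∈ ball ϰ c (A * r), gradNorm ϰ φ u ≤ M) →
      ∀ y ∈ ball ϰ c r, ∀ z ∈ ball ϰ c r, ‖φ y - φ z‖ ≤ A * r * M := by
  set D : ℝ := 2 + 2 ^ (ϰ + 1) * 2 ^ ϰ with hD
  -- `D` keeps the path inside the enlarged ball; the other three terms are the costs of the three
  -- segments.
  set A : ℝ := D + (n₁ * 3 + n₁ ^ ϰ * n₂ * 2 ^ (2 * ϰ + 1) + n₁ * 3) with hA
  have hD1 : 1 ≤ D := by
    have : (0 : ℝ) ≤ 2 ^ (ϰ + 1) * 2 ^ ϰ := by positivity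
    linarith
  have hDA : D ≤ A := le_add_of_nonneg_right (by positivity)
  refine ⟨A, hD1.trans hDA, fun φ hφ c r M hM y hy z hz => ?_⟩
  have hr : 0 < r := (dist_nonneg ϰ c y).trans_lt hy
  have hM0 : 0 ≤ M := (gradNorm_nonneg ϰ φ c).trans
    (hM c (mem_ball_self ϰ c (mul_pos (by linarith) hr)))
  -- When `|c'| ≥ r` the centre itself serves; otherwise a vector of length `r` moves off the
  -- degenerate set.
  obtain ⟨p, hp1, hp2⟩ : ∃ p : EuclideanSpace ℝ (Fin n₁),
      (r + ‖c.1‖) / 2 ≤ ‖p‖ ∧ ‖c.1 - p‖ ≤ 2 * r := by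
    rcases le_total r ‖c.1‖ with h | h
    · exact ⟨c.1, by linarith, by simpa using hr.le⟩
    · refine ⟨EuclideanSpace.single ⟨0, by omega⟩ r, ?_, ?_⟩
      · rw [PiLp.norm_single, Real.norm_of_nonneg hr.le]; linarith
      · refine (norm_sub_le _ _).trans ?_
        rw [PiLp.norm_single, Real.norm_of_nonneg hr.le]; linarith
  have hball : ∀ u : Space n₁ n₂, ‖c.1 - u.1‖ ≤ 2 * r →
      ‖c.2 - u.2‖ ≤ 2 ^ ϰ * (r * (r + ‖c.1‖) ^ ϰ) → gradNorm ϰ φ u ≤ M := by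
    intro u h1 h2
    refine hM u ((dist_lt_of_norm_le hr (one_le_pow₀ (by norm_num)) h1 h2).trans_le ?_)
    gcongr
  have hhor : ∀ y ∈ ball ϰ c r, ‖φ (p, y.2) - φ y‖ ≤ n₁ * 3 * r * M := by
    intro y hy
    have h1 : ‖c.1 - y.1‖ ≤ 2 * r := by linarith [(norm_fst_sub_le_dist ϰ c y).trans_lt hy]
    have h2 := (norm_snd_sub_lt_of_dist_lt hy).le
    have h3 : ‖p - y.1‖ ≤ 3 * r := by
      have : p - y.1 = (c.1 - y.1) - (c.1 - p) := by abel
      rw [this]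
      refine (norm_sub_le _ _).trans ?_
      linarith [(norm_fst_sub_le_dist ϰ c y).trans_lt hy]
    have h4 := norm_sub_le_of_norm_fderiv_segment_le hφ (a := y) (v := (p - y.1, 0))
      (M := n₁ * 3 * r * M) (fun t ht => by
        refine (norm_fderiv_horizontal_le ϰ φ _ _).trans ?_
        rw [mul_assoc (n₁ : ℝ) 3 r]
        refine mul_le_mul (by gcongr) ?_ (gradNorm_nonneg _ _ _) (by positivity)
        refine hball _ ?_ ?_
        · simpa using norm_add_smul_sub_sub_le h1 hp2 ht
        · simpa using h2)
    have h5 : y + (p - y.1, 0) = (p, y.2) := by ext <;> simp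
    rwa [h5] at h4
  have hver : ‖φ (p, y.2) - φ (p, z.2)‖ ≤ n₁ ^ ϰ * n₂ * 2 ^ (2 * ϰ + 1) * r * M := by
    have hy2 := (norm_snd_sub_lt_of_dist_lt hy).le
    have hz2 := (norm_snd_sub_lt_of_dist_lt hz).le
    have hp0 : 0 < ‖p‖ := lt_of_lt_of_le (by positivity) hp1
    have hyz : ‖y.2 - z.2‖ ≤ 2 ^ (2 * ϰ + 1) * r * ‖p‖ ^ ϰ := by
      have : y.2 - z.2 = (c.2 - z.2) - (c.2 - y.2) := by abel
      calc ‖y.2 - z.2‖ ≤ ‖c.2 - z.2‖ + ‖c.2 - y.2‖ := by rw [this]; exact norm_sub_le _ _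
        _ ≤ 2 ^ ϰ * (r * (r + ‖c.1‖) ^ ϰ) + 2 ^ ϰ * (r * (r + ‖c.1‖) ^ ϰ) := by gcongr
        _ = 2 ^ (2 * ϰ + 1) * r * ((r + ‖c.1‖) / 2) ^ ϰ := by
          rw [div_pow, pow_succ, two_mul, pow_add]; field_simp; ring
        _ ≤ _ := by gcongr
    have h4 := norm_sub_le_of_norm_fderiv_segment_le hφ (a := (p, z.2)) (v := (0, y.2 - z.2))
      (M := n₁ ^ ϰ * n₂ * 2 ^ (2 * ϰ + 1) * r * M) (fun t ht => by
        have h6 := norm_pow_mul_norm_fderiv_vertical_le hn₁ ϰ φ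
          ((p, z.2) + t • (0, y.2 - z.2)) (y.2 - z.2)
        have h7 : ((p, z.2) + t • ((0 : EuclideanSpace ℝ (Fin n₁)), y.2 - z.2)).1 = p := by simp
        have h8 : gradNorm ϰ φ ((p, z.2) + t • (0, y.2 - z.2)) ≤ M := by
          refine hball _ (by simpa using hp2) ?_
          simpa using norm_add_smul_sub_sub_le hz2 hy2 ht
        rw [h7] at h6
        refine le_of_mul_le_mul_left (h6.trans ?_) (pow_pos hp0 ϰ)
        calc (n₁ : ℝ) ^ ϰ * n₂ * ‖y.2 - z.2‖ * gradNorm ϰ φ ((p, z.2) + t • (0, y.2 - z.2))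
            ≤ (n₁ : ℝ) ^ ϰ * n₂ * (2 ^ (2 * ϰ + 1) * r * ‖p‖ ^ ϰ) * M :=
              mul_le_mul (by gcongr) h8 (gradNorm_nonneg _ _ _) (by positivity)
          _ = _ := by ring)
    have h5 : ((p, z.2) : Space n₁ n₂) + (0, y.2 - z.2) = (p, y.2) := by ext <;> simp
    rwa [h5] at h4
  have e : φ y - φ z = -(φ (p, y.2) - φ y) + (φ (p, y.2) - φ (p, z.2)) +
      (φ (p, z.2) - φ z) := by ring
  rw [e]
  refine (norm_add₃_le).trans ?_
  rw [norm_neg]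
  have h0 : 0 ≤ D * r * M := by positivity
  have := hhor y hy
  have := hhor z hz
  calc _ ≤ n₁ * 3 * r * M + n₁ ^ ϰ * n₂ * 2 ^ (2 * ϰ + 1) * r * M + n₁ * 3 * r * M := by
        gcongr
    _ ≤ D * r * M + (n₁ * 3 * r * M + n₁ ^ ϰ * n₂ * 2 ^ (2 * ϰ + 1) * r * M +
        n₁ * 3 * r * M) := le_add_of_nonneg_left h0
    _ = A * r * M := by rw [hA]; ring

end Grushin

namespace Grushin

open Filter Topology

variable {n₁ n₂ : ℕ}

/-! ### Pointwise estimates of the kernels -/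

/-- Converts bounds weighted by `|B(x, t)|^{1/2} |B(w, t)|^{1/2} d(x, w)^𝔯` into decay relative to
the size of `B(c, ρ)`. -/
lemma exists_mul_boxVol_le (n₁ n₂ ϰ : ℕ) {R₀ ε A : ℝ} (hR₀ : 0 ≤ R₀) (hε : 0 ≤ ε)
    (hεR : ε ≤ R₀ - homDim ϰ n₁ n₂) (hA : 1 ≤ A) :
    ∃ B : ℝ, 0 ≤ B ∧ ∀ (c x w : Space n₁ n₂) (ρ t N D : ℝ), 0 < ρ → 0 < t → 0 ≤ N →
      (∀ 𝔯 ∈ Set.Icc 0 R₀, ballVol ϰ x t ^ (1 / 2 : ℝ) * ballVol ϰ w t ^ (1 / 2 : ℝ) *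
        dist ϰ x w ^ 𝔯 * N ≤ D * t ^ 𝔯) →
      ‖c.1 - x.1‖ ≤ A * ρ → ‖c.1 - w.1‖ ≤ A * ρ → ρ ≤ A * max t (dist ϰ x w) →
      N * boxVol ϰ c ρ ≤ B * D * (t / ρ) ^ ε := by
  obtain ⟨a, b, ha, hb, hvol⟩ := exists_volume_ball_bounds n₁ n₂ ϰ
  set Q : ℕ := n₁ + (1 + ϰ) * n₂ with hQ
  have hQ' : homDim ϰ n₁ n₂ = (Q : ℝ) := by rw [homDim, hQ]; push_cast; ring
  set P : ℝ := (1 + A) ^ (ϰ * n₂) / a with hP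
  have hP0 : 0 < P := by positivity
  refine ⟨P * A ^ R₀, by positivity, fun c x w ρ t N D hρ ht hN h hx hw hρA => ?_⟩
  set m : ℝ := max 1 (ρ / t) with hm
  have hm1 : 1 ≤ m := le_max_left _ _
  have hρm : ρ ≤ m * t := (div_le_iff₀ ht).1 (le_max_right _ _)
  set v := boxVol ϰ c ρ with hv
  have hv0 : 0 < v := boxVol_pos ϰ c hρ
  set d := dist ϰ x w with hd
  have hd0 : 0 ≤ d := dist_nonneg ϰ x w
  -- Passing from radius `t` to radius `ρ` costs `m^Q` by doubling; the change of centre costs only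
  -- a constant.
  have hball : ∀ u : Space n₁ n₂, ‖c.1 - u.1‖ ≤ A * ρ → v / (P * m ^ Q) ≤ ballVol ϰ u t := by
    intro u hu
    have h1 : a * boxVol ϰ u t ≤ ballVol ϰ u t := by
      have htop : volume (ball ϰ u t) ≠ ⊤ :=
        ((hvol u t ht).2.trans_lt ENNReal.ofReal_lt_top).ne
      exact (ENNReal.ofReal_le_iff_le_toReal htop).1 (hvol u t ht).1
    have h2 : v ≤ (1 + A) ^ (ϰ * n₂) * (m ^ Q * boxVol ϰ u t) := by
      refine (boxVol_le_of_norm_sub_le ϰ hρ (by linarith) hu).trans ?_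
      gcongr
      exact (boxVol_mono ϰ u hρ hρm).trans (boxVol_mul_le ϰ u ht hm1)
    rw [div_le_iff₀ (by positivity)]
    calc v ≤ (1 + A) ^ (ϰ * n₂) * (m ^ Q * boxVol ϰ u t) := h2
      _ = a * boxVol ϰ u t * (P * m ^ Q) := by rw [hP]; field_simp
      _ ≤ _ := by gcongr
  set S := ballVol ϰ x t ^ (1 / 2 : ℝ) * ballVol ϰ w t ^ (1 / 2 : ℝ) with hS
  have hS1 : v / (P * m ^ Q) ≤ S := by
    have h0 : 0 < v / (P * m ^ Q) := by positivity
    calc v / (P * m ^ Q) = (v / (P * m ^ Q)) ^ (1 / 2 : ℝ) * (v / (P * m ^ Q)) ^ (1 / 2 : ℝ) := by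
          rw [← Real.rpow_add h0]; norm_num
      _ ≤ S := by
          have h1 := h0.le.trans (hball x hx)
          exact mul_le_mul (Real.rpow_le_rpow h0.le (hball x hx) (by norm_num))
            (Real.rpow_le_rpow h0.le (hball w hw) (by norm_num)) (by positivity) (by positivity)
  have hS0 : 0 ≤ S := le_trans (by positivity) hS1
  -- Only the endpoint exponents are used: `𝔯 = 0` when `d ≤ t`, where `m` is bounded, and `𝔯 = R₀`
  -- when `d > t`, where `m` is at most a multiple of `d / t`.
  have key : m ^ R₀ * (S * N) ≤ A ^ R₀ * D := by
    rcases le_or_gt d t with hdt | hdt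
    · have h1 := h 0 ⟨le_rfl, hR₀⟩
      simp only [Real.rpow_zero, mul_one] at h1
      rw [max_eq_left hdt] at hρA
      have h2 : m ≤ A := max_le hA ((div_le_iff₀ ht).2 hρA)
      exact mul_le_mul (by gcongr) h1 (by positivity) (by positivity)
    · have h1 := h R₀ ⟨hR₀, le_rfl⟩
      rw [max_eq_right hdt.le] at hρA
      have hdt' : 1 ≤ d / t := (one_le_div ht).2 hdt.le
      have h2 : m ≤ A * (d / t) := by
        refine max_le (by nlinarith) ?_
        rw [← mul_div_assoc]
        gcongr
      calc m ^ R₀ * (S * N) ≤ (A * (d / t)) ^ R₀ * (S * N) := by gcongr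
        _ = A ^ R₀ * (S * d ^ R₀ * N) / t ^ R₀ := by
          rw [Real.mul_rpow (by positivity) (by positivity), Real.div_rpow hd0 ht.le]; ring
        _ ≤ A ^ R₀ * (D * t ^ R₀) / t ^ R₀ := by gcongr
        _ = A ^ R₀ * D := by field_simp
  -- The surplus `R₀ - Q` is spent here: `m^R₀` pays for the volume loss and for the remaining
  -- decay.
  have hmR : (ρ / t) ^ ε * m ^ Q ≤ m ^ R₀ := by
    calc (ρ / t) ^ ε * m ^ Q ≤ m ^ ε * m ^ (Q : ℝ) := by
          rw [Real.rpow_natCast]; gcongr; exact le_max_right _ _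
      _ = m ^ (ε + Q) := (Real.rpow_add (by positivity) _ _).symm
      _ ≤ m ^ R₀ := Real.rpow_le_rpow_of_exponent_le hm1 (by linarith)
  have hinv : (t / ρ) ^ ε = ((ρ / t) ^ ε)⁻¹ := by
    rw [← Real.inv_rpow (by positivity), inv_div]
  rw [hinv, ← div_eq_mul_inv, le_div_iff₀ (by positivity)]
  rw [div_le_iff₀ (by positivity)] at hS1
  calc N * v * (ρ / t) ^ ε ≤ N * (S * (P * m ^ Q)) * (ρ / t) ^ ε := by gcongr
    _ = P * (((ρ / t) ^ ε * m ^ Q) * (S * N)) := by ring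
    _ ≤ P * (m ^ R₀ * (S * N)) := by gcongr
    _ ≤ P * (A ^ R₀ * D) := by gcongr
    _ = _ := by ring

lemma two_rpow_neg_half_rpow (j : ℕ) (𝔯 : ℝ) :
    (2 : ℝ) ^ (-((j : ℝ) * 𝔯) / 2) = (2 ^ (-(j : ℝ) / 2)) ^ 𝔯 := by
  rw [← Real.rpow_mul (by norm_num)]
  congr 1
  ring

variable {ϰ : ℕ} {C₀ s R₀ ε : ℝ} {K : ℕ → Space n₁ n₂ → Space n₁ n₂ → ℂ}

lemma KernelSup.exists_norm_sub_mul_boxVol_le (hsup : KernelSup ϰ K R₀) (hC₀ : 1 < C₀)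
    (hquasi : ∀ x y z : Space n₁ n₂, dist ϰ x y ≤ C₀ * (dist ϰ x z + dist ϰ z y))
    (hs : 2 * C₀ ≤ s) (hR₀ : 0 ≤ R₀) (hε : 0 ≤ ε) (hεR : ε ≤ R₀ - homDim ϰ n₁ n₂) :
    ∃ C : ℝ, 0 ≤ C ∧ ∀ (j : ℕ) (c w y z : Space n₁ n₂) (r : ℝ), 0 < r →
      y ∈ ball ϰ c r → z ∈ ball ϰ c r → s * r ≤ dist ϰ c w →
      ‖K j y w - K j z w‖ * boxVol ϰ c (dist ϰ c w) ≤
        C * (2 ^ (-(j : ℝ) / 2) / dist ϰ c w) ^ ε := by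
  obtain ⟨C, hC⟩ := hsup
  obtain ⟨B, hB, hBb⟩ := exists_mul_boxVol_le n₁ n₂ ϰ hR₀ hε hεR (A := 2 * C₀) (by linarith)
  refine ⟨B * |C| + B * |C|, by positivity, fun j c w y z r hr hy hz hw => ?_⟩
  set ρ := dist ϰ c w with hρ
  set t : ℝ := 2 ^ (-(j : ℝ) / 2) with ht
  have ht0 : 0 < t := by positivity
  have hrρ : 2 * C₀ * r ≤ ρ := le_trans (by gcongr) hw
  have hρ0 : 0 < ρ := lt_of_lt_of_le (by positivity) hrρ
  have hone : ∀ y ∈ ball ϰ c r, ‖K j y w‖ * boxVol ϰ c ρ ≤ B * |C| * (t / ρ) ^ ε := by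
    intro y hy
    have hy' : dist ϰ c y < r := hy
    refine hBb c y w ρ t _ _ hρ0 ht0 (norm_nonneg _) (fun 𝔯 h𝔯 => ?_) ?_ ?_ ?_
    · rw [ht, ← two_rpow_neg_half_rpow]
      refine (hC j 𝔯 h𝔯 y w).trans ?_
      gcongr
      exact le_abs_self C
    · have := norm_fst_sub_le_dist ϰ c y
      nlinarith
    · have := norm_fst_sub_le_dist ϰ c w
      nlinarith
    -- Since `C₀ r ≤ ρ / 2`, the term `C₀ d(c, y)` is absorbed, leaving `ρ ≤ 2 C₀ d(y, w)`. This is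
    -- where `s ≥ 2 C₀` is needed.
    · have h1 := hquasi c w y
      have h2 : C₀ * dist ϰ y w ≤ C₀ * max t (dist ϰ y w) := by gcongr; exact le_max_right _ _
      nlinarith
  calc ‖K j y w - K j z w‖ * boxVol ϰ c ρ ≤ (‖K j y w‖ + ‖K j z w‖) * boxVol ϰ c ρ := by
        have := boxVol_pos ϰ c hρ0
        gcongr
        exact norm_sub_le _ _
    _ ≤ _ := by rw [add_mul, add_mul]; exact add_le_add (hone y hy) (hone z hz)

lemma KernelGradSup.exists_norm_sub_mul_boxVol_le (hgrad : KernelGradSup ϰ K R₀) (hn₁ : 1 ≤ n₁)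
    (hC₀ : 1 < C₀)
    (hquasi : ∀ x y z : Space n₁ n₂, dist ϰ x y ≤ C₀ * (dist ϰ x z + dist ϰ z y))
    (hs : 2 * C₀ ≤ s) (hR₀ : 0 ≤ R₀) (hε : 0 ≤ ε) (hεR : ε ≤ R₀ - homDim ϰ n₁ n₂) :
    ∃ C : ℝ, 0 ≤ C ∧ ∀ (j : ℕ) (c w y z : Space n₁ n₂) (r : ℝ), 0 < r →
      y ∈ ball ϰ c r → z ∈ ball ϰ c r → s * r ≤ dist ϰ c w →
      r ≤ 2 ^ (-(j : ℝ) / 2) → dist ϰ c w < 1 →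
      ‖K j y w - K j z w‖ * boxVol ϰ c (dist ϰ c w) ≤
        C * (r / 2 ^ (-(j : ℝ) / 2)) * (2 ^ (-(j : ℝ) / 2) / dist ϰ c w) ^ ε := by
  obtain ⟨A, hA, hmv⟩ := exists_norm_sub_le_of_gradNorm_le hn₁ n₂ ϰ
  -- For `u` in `B(c, A r)` with `r ≤ ρ < 1`, one has `d(u, w) < C₀ (A + 1)`, so the local gradient
  -- bound applies along the whole path.
  obtain ⟨C, hC⟩ := hgrad.2 (C₀ * (A + 1)) (by positivity)
  obtain ⟨B, hB, hBb⟩ := exists_mul_boxVol_le n₁ n₂ ϰ hR₀ hε hεR (A := C₀ * (A + 1)) (by nlinarith)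
  refine ⟨A * (B * |C|), by positivity, fun j c w y z r hr hy hz hw hrt hρ1 => ?_⟩
  set ρ := dist ϰ c w with hρ
  set t : ℝ := 2 ^ (-(j : ℝ) / 2) with ht
  have ht0 : 0 < t := by positivity
  have hrρ : 2 * C₀ * r ≤ ρ := le_trans (by gcongr) hw
  have hrρ' : r ≤ ρ := le_trans (by nlinarith) hrρ
  have hρ0 : 0 < ρ := hr.trans_le hrρ'
  have hv0 : 0 < boxVol ϰ c ρ := boxVol_pos ϰ c hρ0
  have hAC : A ≤ C₀ * (A + 1) := by nlinarith
  have htinv : (2 : ℝ) ^ ((j : ℝ) / 2) = t⁻¹ := by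
    rw [ht, ← Real.rpow_neg (by norm_num)]; congr 1; ring
  have hone : ∀ u ∈ ball ϰ c (A * r), gradNorm ϰ (fun u => K j u w) u ≤
      B * (|C| * t⁻¹) * (t / ρ) ^ ε / boxVol ϰ c ρ := by
    intro u hu
    have hu' : dist ϰ c u < A * r := hu
    have hAr : A * r ≤ A * ρ := by gcongr
    rw [le_div_iff₀ hv0]
    refine hBb c u w ρ t _ _ hρ0 ht0 (gradNorm_nonneg _ _ _) (fun 𝔯 h𝔯 => ?_) ?_ ?_ ?_
    · have hd : dist ϰ u w < C₀ * (A + 1) := by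
        refine (hquasi u w c).trans_lt ?_
        rw [dist_comm ϰ u c]
        gcongr
        nlinarith
      rw [ht, ← two_rpow_neg_half_rpow, ← ht, ← htinv]
      refine (hC j 𝔯 h𝔯 u w hd).trans ?_
      rw [mul_assoc, mul_comm ((2 : ℝ) ^ ((j : ℝ) / 2))]
      gcongr
      exact le_abs_self C
    · have := norm_fst_sub_le_dist ϰ c u
      nlinarith
    · have := norm_fst_sub_le_dist ϰ c w
      nlinarith
    · have h1 := hquasi c w u
      calc ρ ≤ C₀ * (dist ϰ c u + dist ϰ u w) := h1
        _ ≤ C₀ * (A * max t (dist ϰ u w) + max t (dist ϰ u w)) := by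
          gcongr
          · refine hu'.le.trans ?_
            gcongr
            exact hrt.trans (le_max_left _ _)
          · exact le_max_right _ _
        _ = _ := by ring
  have := hmv (fun u => K j u w) (hgrad.1 j w) c r _ hone y hy z hz
  rw [← mul_div_assoc, le_div_iff₀ hv0] at this
  refine this.trans (le_of_eq ?_)
  field_simp

/-- Rounding the real centre `v` to its floor costs a factor `q⁻¹` and leaves a two-sided geometric
series, bounded independently of `v`. -/
lemma exists_sum_rpow_abs_sub_le {q : ℝ} (hq0 : 0 < q) (hq1 : q < 1) :
    ∃ C : ℝ, 0 ≤ C ∧ ∀ (v : ℝ) (J : ℕ), ∑ j ∈ Finset.range J, q ^ |(j : ℝ) - v| ≤ C := by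
  have hsum : Summable fun k : ℤ => q ^ k.natAbs := by
    refine Summable.of_nat_of_neg ?_ ?_ <;>
      simpa using summable_geometric_of_lt_one hq0.le hq1
  refine ⟨q⁻¹ * ∑' k : ℤ, q ^ k.natAbs,
    mul_nonneg (by positivity) (tsum_nonneg fun k => by positivity), fun v J => ?_⟩
  have hinj : Set.InjOn (fun j : ℕ => (j : ℤ) - ⌊v⌋) (Finset.range J : Set ℕ) :=
    fun i _ j _ h => by simpa using h
  calc ∑ j ∈ Finset.range J, q ^ |(j : ℝ) - v|
      ≤ ∑ j ∈ Finset.range J, q⁻¹ * q ^ ((j : ℤ) - ⌊v⌋).natAbs := by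
        refine Finset.sum_le_sum fun j _ => ?_
        rw [← Real.rpow_natCast, ← Real.rpow_neg_one, ← Real.rpow_add hq0]
        refine Real.rpow_le_rpow_of_exponent_ge hq0 hq1.le ?_
        have h1 : (((j : ℤ) - ⌊v⌋).natAbs : ℝ) = |(j : ℝ) - ⌊v⌋| := by
          rw [Nat.cast_natAbs]; push_cast; rfl
        rw [h1]
        have h2 := Int.floor_le v
        have h3 := Int.lt_floor_add_one v
        have h4 : |(j : ℝ) - ⌊v⌋| ≤ |(j : ℝ) - v| + |v - ⌊v⌋| := by
          have := abs_add_le ((j : ℝ) - v) (v - ⌊v⌋)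
          rwa [sub_add_sub_cancel] at this
        have h5 : |v - ⌊v⌋| ≤ 1 := abs_le.2 ⟨by linarith, by linarith⟩
        linarith
    _ = q⁻¹ * ∑ k ∈ (Finset.range J).image (fun j : ℕ => (j : ℤ) - ⌊v⌋), q ^ k.natAbs := by
        rw [Finset.sum_image hinj, Finset.mul_sum]
    _ ≤ _ := by
        gcongr
        exact hsum.sum_le_tsum _ fun k _ => by positivity

/-- The summed regularity estimate of the kernels. -/
lemma exists_sum_norm_sub_mul_boxVol_le (hsup : KernelSup ϰ K R₀) (hgrad : KernelGradSup ϰ K R₀)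
    (hn₁ : 1 ≤ n₁) (hC₀ : 1 < C₀)
    (hquasi : ∀ x y z : Space n₁ n₂, dist ϰ x y ≤ C₀ * (dist ϰ x z + dist ϰ z y))
    (hs : 2 * C₀ ≤ s) (hR₀ : 0 ≤ R₀) (hε : 0 < ε) (hε' : ε ≤ 1 / 2)
    (hεR : ε ≤ R₀ - homDim ϰ n₁ n₂) :
    ∃ C : ℝ, 0 ≤ C ∧ ∀ (J : ℕ) (c w y z : Space n₁ n₂) (r : ℝ), 0 < r →
      y ∈ ball ϰ c r → z ∈ ball ϰ c r → s * r ≤ dist ϰ c w →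
      (∑ j ∈ Finset.range J, ‖K j y w - K j z w‖) * boxVol ϰ c (dist ϰ c w) ≤
        C * ((if dist ϰ c w < 1 then r else 1) / dist ϰ c w) ^ ε := by
  obtain ⟨C, hC, h1⟩ := hsup.exists_norm_sub_mul_boxVol_le hC₀ hquasi hs hR₀ hε.le hεR
  obtain ⟨C', hC', h2⟩ := hgrad.exists_norm_sub_mul_boxVol_le hn₁ hC₀ hquasi hs hR₀ hε.le hεR
  set q : ℝ := 2 ^ (-ε / 2) with hq
  obtain ⟨D, hD, h3⟩ := exists_sum_rpow_abs_sub_le (q := q) (by positivity)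
    (Real.rpow_lt_one_of_one_lt_of_neg (by norm_num) (by linarith))
  refine ⟨max C C' * D, by positivity, fun J c w y z r hr hy hz hw => ?_⟩
  set ρ := dist ϰ c w with hρ
  have hρ0 : 0 < ρ := lt_of_lt_of_le (by nlinarith) hw
  have hqpow : ∀ x : ℝ, q ^ x = (2 ^ (-x / 2)) ^ ε := fun x => by
    rw [hq, ← Real.rpow_mul (by norm_num), ← Real.rpow_mul (by norm_num)]
    congr 1; ring
  -- It is enough that the terms decay geometrically on both sides of some critical index `v`.
  suffices h : ∃ v : ℝ, ∀ j : ℕ, ‖K j y w - K j z w‖ * boxVol ϰ c ρ ≤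
      max C C' * ((if ρ < 1 then r else 1) / ρ) ^ ε * q ^ |(j : ℝ) - v| by
    obtain ⟨v, hv⟩ := h
    have hpos : 0 ≤ (if ρ < 1 then r else 1) / ρ := by split_ifs <;> positivity
    calc (∑ j ∈ Finset.range J, ‖K j y w - K j z w‖) * boxVol ϰ c ρ
        ≤ ∑ j ∈ Finset.range J,
          max C C' * ((if ρ < 1 then r else 1) / ρ) ^ ε * q ^ |(j : ℝ) - v| := by
          rw [Finset.sum_mul]; exact Finset.sum_le_sum fun j _ => hv j
      _ ≤ max C C' * ((if ρ < 1 then r else 1) / ρ) ^ ε * D := by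
          rw [← Finset.mul_sum]; gcongr; exact h3 v J
      _ = _ := by ring
  split_ifs with hρ1
  · have hr2 : (2 : ℝ) ^ (Real.logb 2 r) = r := Real.rpow_logb (by norm_num) (by norm_num) hr
    -- At this index `2^(-j/2)` equals `r`: below it the gradient estimate is used, above it the
    -- size estimate.
    refine ⟨-2 * Real.logb 2 r, fun j => ?_⟩
    set t : ℝ := 2 ^ (-(j : ℝ) / 2) with ht
    have ht0 : 0 < t := by positivity
    rcases le_or_gt r t with hrt | hrt
    · have hj : (j : ℝ) - -2 * Real.logb 2 r ≤ 0 := by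
        rw [← hr2, ht, Real.rpow_le_rpow_left_iff (by norm_num)] at hrt
        linarith
      have e1 : q ^ |(j : ℝ) - -2 * Real.logb 2 r| = (r / t) ^ ε := by
        rw [hqpow, abs_of_nonpos hj]
        congr 1
        nth_rewrite 2 [← hr2]
        rw [ht, ← Real.rpow_sub (by norm_num)]
        congr 1; ring
      rw [e1]
      refine (h2 j c w y z r hr hy hz hw hrt hρ1).trans ?_
      have e2 : t / ρ = (t / r) * (r / ρ) := by field_simp
      -- The gain `r / t` must beat the loss `(t / r)^ε` and still leave `(r / t)^ε`; this requires
      -- `1 - ε ≥ ε`.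
      have e3 : r / t * (t / r) ^ ε ≤ (r / t) ^ ε := by
        have hrt1 : r / t ≤ 1 := (div_le_one ht0).2 hrt
        have hrt0 : 0 < r / t := by positivity
        calc r / t * (t / r) ^ ε = (r / t) ^ (1 + -ε) := by
              rw [Real.rpow_add hrt0, Real.rpow_one, Real.rpow_neg hrt0.le,
                ← Real.inv_rpow hrt0.le, inv_div]
          _ ≤ (r / t) ^ ε := Real.rpow_le_rpow_of_exponent_ge hrt0 hrt1 (by linarith)
      calc C' * (r / t) * (t / ρ) ^ ε = C' * (r / ρ) ^ ε * (r / t * (t / r) ^ ε) := by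
            rw [e2, Real.mul_rpow (by positivity) (by positivity)]; ring
        _ ≤ max C C' * (r / ρ) ^ ε * (r / t) ^ ε := by gcongr; exact le_max_right _ _
    · have hj : 0 ≤ (j : ℝ) - -2 * Real.logb 2 r := by
        rw [← hr2, ht, Real.rpow_lt_rpow_left_iff (by norm_num)] at hrt
        linarith
      have e1 : q ^ |(j : ℝ) - -2 * Real.logb 2 r| = (t / r) ^ ε := by
        rw [hqpow, abs_of_nonneg hj]
        congr 1
        nth_rewrite 2 [← hr2]
        rw [ht, ← Real.rpow_sub (by norm_num)]
        congr 1; ring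
      rw [e1]
      refine (h1 j c w y z r hr hy hz hw).trans ?_
      calc C * (t / ρ) ^ ε ≤ max C C' * (t / ρ) ^ ε := by gcongr; exact le_max_left _ _
        _ = max C C' * (r / ρ * (t / r)) ^ ε := by congr 2; field_simp
        _ = _ := by rw [Real.mul_rpow (by positivity) (by positivity)]; ring
  -- At distance at least `1` the sum runs over `j ≥ 0` only, so the size estimate already decays
  -- from the critical index `0` on.
  · refine ⟨0, fun j => ?_⟩
    rw [hqpow, sub_zero, abs_of_nonneg (by positivity)]
    refine (h1 j c w y z r hr hy hz hw).trans ?_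
    calc C * (2 ^ (-(j : ℝ) / 2) / ρ) ^ ε ≤ max C C' * (2 ^ (-(j : ℝ) / 2) / ρ) ^ ε := by
          gcongr; exact le_max_left _ _
      _ = max C C' * (1 / ρ * 2 ^ (-(j : ℝ) / 2)) ^ ε := by congr 2; ring
      _ = _ := by rw [Real.mul_rpow (by positivity) (by positivity)]; ring

end Grushin

namespace Grushin

open Filter Topology

variable {n₁ n₂ : ℕ}

/-! ### Domination by the maximal function -/

lemma measurable_boxVol_dist (ϰ : ℕ) (c : Space n₁ n₂) :
    Measurable fun w => boxVol ϰ c (dist ϰ c w) := by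
  have := measurable_dist_right ϰ c
  unfold boxVol
  fun_prop

/-- Averages against a decaying radial weight outside a ball are controlled by the maximal
function. -/
lemma exists_lintegral_decay_le_maximal (n₁ n₂ ϰ : ℕ) {ε : ℝ} (hε : 0 < ε) :
    ∃ C : ℝ≥0, ∀ (f : Space n₁ n₂ → ℂ) (c x : Space n₁ n₂) (a : ℝ), 0 < a → x ∈ ball ϰ c a →
      ∫⁻ w in {w | a ≤ dist ϰ c w},
        ENNReal.ofReal ((a / dist ϰ c w) ^ ε / boxVol ϰ c (dist ϰ c w)) * ‖f w‖ₑ ≤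
      C * maximal ϰ f x := by
  obtain ⟨b, hb, hmax⟩ := lintegral_ball_le_maximal n₁ n₂ ϰ
  set Q : ℕ := n₁ + (1 + ϰ) * n₂
  set θ : ℝ := 2 ^ (-ε) with hθ
  have hθ0 : 0 < θ := by positivity
  have hθ1 : θ < 1 := Real.rpow_lt_one_of_one_lt_of_neg (by norm_num) (by linarith)
  have hsum : Summable fun k : ℕ => θ ^ k * (b * 2 ^ Q) :=
    (summable_geometric_of_lt_one hθ0.le hθ1).mul_right _
  refine ⟨(∑' k : ℕ, θ ^ k * (b * 2 ^ Q)).toNNReal, fun f c x a ha hx => ?_⟩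
  -- On the `k`-th annulus the weight is at most `2^(-kε) / |B|` up to constants, and the ball of
  -- radius `2^(k+1) a` containing the annulus also contains `x`.
  let A : ℕ → Set (Space n₁ n₂) := fun k => dist ϰ c ⁻¹' Set.Ico (2 ^ k * a) (2 ^ (k + 1) * a)
  have hA : ∀ k, MeasurableSet (A k) := fun k => measurable_dist_right ϰ c measurableSet_Ico
  have hcover : {w | a ≤ dist ϰ c w} ⊆ ⋃ k, A k := by
    intro w hw
    obtain ⟨k, hk1, hk2⟩ := exists_nat_pow_near ((one_le_div ha).2 hw) (one_lt_two (α := ℝ))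
    rw [le_div_iff₀ ha] at hk1
    rw [div_lt_iff₀ ha] at hk2
    exact Set.mem_iUnion.2 ⟨k, hk1, hk2⟩
  have hpiece : ∀ k, ∫⁻ w in A k,
      ENNReal.ofReal ((a / dist ϰ c w) ^ ε / boxVol ϰ c (dist ϰ c w)) * ‖f w‖ₑ ≤
      ENNReal.ofReal (θ ^ k * (b * 2 ^ Q)) * maximal ϰ f x := by
    intro k
    set R : ℝ := 2 ^ k * a with hR
    have hR0 : 0 < R := by positivity
    have hV0 := boxVol_pos ϰ c hR0
    have h2R : (2 : ℝ) ^ (k + 1) * a = 2 * R := by rw [hR]; ring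
    have hxR : x ∈ ball ϰ c (2 * R) := by
      refine lt_of_lt_of_le (show dist ϰ c x < a from hx) ?_
      have : (1 : ℝ) ≤ 2 ^ k := one_le_pow₀ (by norm_num)
      nlinarith
    calc ∫⁻ w in A k, ENNReal.ofReal ((a / dist ϰ c w) ^ ε / boxVol ϰ c (dist ϰ c w)) * ‖f w‖ₑ
        ≤ ∫⁻ w in A k, ENNReal.ofReal (θ ^ k / boxVol ϰ c R) * ‖f w‖ₑ := by
          refine setLIntegral_mono' (hA k) fun w hw => ?_
          have hw1 : R ≤ dist ϰ c w := hw.1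
          have hd0 : 0 < dist ϰ c w := hR0.trans_le hw1
          have h1 : (a / dist ϰ c w) ^ ε ≤ θ ^ k := by
            have : θ ^ k = (a / R) ^ ε := by
              rw [hθ, hR, ← Real.rpow_natCast, ← Real.rpow_mul (by norm_num),
                div_mul_cancel_right₀ ha.ne', Real.inv_rpow (by positivity),
                ← Real.rpow_natCast, ← Real.rpow_mul (by norm_num),
                ← Real.rpow_neg (by norm_num)]
              congr 1; ring
            rw [this]
            gcongr
          gcongr
          exact boxVol_mono ϰ c hR0 hw1
      _ = ENNReal.ofReal (θ ^ k / boxVol ϰ c R) * ∫⁻ w in A k, ‖f w‖ₑ :=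
          lintegral_const_mul' _ _ ENNReal.ofReal_ne_top
      _ ≤ ENNReal.ofReal (θ ^ k / boxVol ϰ c R) * ∫⁻ w in ball ϰ c (2 * R), ‖f w‖ₑ := by
          gcongr
          intro w hw
          rw [← h2R]
          exact hw.2
      _ ≤ ENNReal.ofReal (θ ^ k / boxVol ϰ c R) *
            (ENNReal.ofReal (b * boxVol ϰ c (2 * R)) * maximal ϰ f x) := by
          gcongr
          exact hmax f c x _ hxR
      _ ≤ ENNReal.ofReal (θ ^ k / boxVol ϰ c R) *
            (ENNReal.ofReal (b * (2 ^ Q * boxVol ϰ c R)) * maximal ϰ f x) := by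
          gcongr
          exact boxVol_mul_le ϰ c hR0 one_le_two
      _ = _ := by
          rw [← mul_assoc, ← ENNReal.ofReal_mul (by positivity)]
          congr 2
          field_simp
  calc _ ≤ ∫⁻ w in ⋃ k, A k,
        ENNReal.ofReal ((a / dist ϰ c w) ^ ε / boxVol ϰ c (dist ϰ c w)) * ‖f w‖ₑ :=
        lintegral_mono_set hcover
    _ ≤ ∑' k, ∫⁻ w in A k,
        ENNReal.ofReal ((a / dist ϰ c w) ^ ε / boxVol ϰ c (dist ϰ c w)) * ‖f w‖ₑ :=
        lintegral_iUnion_le _ _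
    _ ≤ ∑' k, ENNReal.ofReal (θ ^ k * (b * 2 ^ Q)) * maximal ϰ f x :=
        ENNReal.tsum_le_tsum hpiece
    _ = _ := by
        rw [ENNReal.tsum_mul_right,
          ← ENNReal.ofReal_tsum_of_nonneg (fun k => by positivity) hsum]
        rfl

/-- Superadditivity of the lower integral holds for arbitrary functions, so no measurability of
kernel sections has to be checked. -/
lemma sum_lintegral_le_lintegral_sum {α ι : Type*} [MeasurableSpace α] (μ : Measure α)
    (s : Finset ι) (F : ι → α → ℝ≥0∞) :
    ∑ i ∈ s, ∫⁻ a, F i a ∂μ ≤ ∫⁻ a, ∑ i ∈ s, F i a ∂μ := by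
  classical
  induction s using Finset.induction_on with
  | empty => simp
  | insert i s hi ih =>
    simp only [Finset.sum_insert hi]
    exact (add_le_add_right ih _).trans (le_lintegral_add _ _)

lemma IsBddCompactlySupported.indicator {f : Space n₁ n₂ → ℂ} (hf : IsBddCompactlySupported f)
    {E : Set (Space n₁ n₂)} (hE : MeasurableSet E) : IsBddCompactlySupported (E.indicator f) := by
  obtain ⟨h1, ⟨M, hM⟩, h3⟩ := hf
  refine ⟨h1.indicator hE, ⟨M, fun x => (norm_indicator_le_norm_self f x).trans (hM x)⟩,
    h3.mono fun x hx h => hx ?_⟩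
  simp [h]

lemma IsBddCompactlySupported.memLp {f : Space n₁ n₂ → ℂ} (hf : IsBddCompactlySupported f)
    (p : ℝ≥0∞) : MemLp f p volume := by
  obtain ⟨h1, ⟨M, hM⟩, h3⟩ := hf
  exact h3.memLp_of_bound h1.aestronglyMeasurable M (Eventually.of_forall hM)

lemma ae_prod_restrict_of_ae {α : Type*} [MeasurableSpace α] {μ : Measure α} [SFinite μ]
    {P : α → Prop} (hP : ∀ᵐ a ∂μ, P a) {B : Set α} (hB : MeasurableSet B) :
    ∀ᵐ p ∂(μ.restrict B).prod (μ.restrict B), (P p.1 ∧ p.1 ∈ B) ∧ P p.2 ∧ p.2 ∈ B := by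
  have h : ∀ᵐ a ∂μ.restrict B, P a ∧ a ∈ B :=
    (ae_restrict_of_ae hP).and (ae_restrict_mem hB)
  exact (Measure.quasiMeasurePreserving_fst.ae h).and (Measure.quasiMeasurePreserving_snd.ae h)

variable {ϰ : ℕ} {C₀ s R₀ : ℝ} {K : ℕ → Space n₁ n₂ → Space n₁ n₂ → ℂ}

lemma exists_ae_enorm_sub_le_maximal (V : Potential) (hn₁ : 1 ≤ n₁) (hC₀ : 1 < C₀)
    (hquasi : ∀ x y z : Space n₁ n₂, dist ϰ x y ≤ C₀ * (dist ϰ x z + dist ϰ z y))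
    (hs : 2 * C₀ ≤ s) (T : L2 n₁ n₂ →L[ℂ] L2 n₁ n₂)
    (hK : ∀ j, IsIntegralKernel (T.comp (chi V ϰ n₁ n₂ j)) (K j))
    (hR₀ : homDim ϰ n₁ n₂ < R₀) (hsup : KernelSup ϰ K R₀) (hgrad : KernelGradSup ϰ K R₀) :
    ∃ C : ℝ≥0, ∀ f : Space n₁ n₂ → ℂ, IsBddCompactlySupported f →
      ∀ (c x : Space n₁ n₂) (r : ℝ), 0 < r → x ∈ ball ϰ c r →
      ∀ᵐ p ∂(volume.restrict (ball ϰ c r)).prod (volume.restrict (ball ϰ c r)),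
        ‖applyFun T ((ball ϰ c (s * r))ᶜ.indicator f) p.1 -
          applyFun T ((ball ϰ c (s * r))ᶜ.indicator f) p.2‖ₑ ≤ C * maximal ϰ f x := by
  have hQ0 : 0 ≤ homDim ϰ n₁ n₂ := by unfold homDim; positivity
  set ε : ℝ := min (R₀ - homDim ϰ n₁ n₂) (1 / 2) with hε
  have hε0 : 0 < ε := lt_min (by linarith) (by norm_num)
  obtain ⟨C, hC, hsum⟩ := exists_sum_norm_sub_mul_boxVol_le hsup hgrad hn₁ hC₀ hquasi hs
    (by linarith) hε0 (min_le_right _ _) (min_le_left _ _)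
  obtain ⟨D, hD⟩ := exists_lintegral_decay_le_maximal n₁ n₂ ϰ hε0
  refine ⟨C.toNNReal * (D + D), fun f hf c x r hr hx => ?_⟩
  have hs1 : 1 ≤ s := by linarith
  have hsr : r ≤ s * r := le_mul_of_one_le_left hr.le hs1
  set g := (ball ϰ c (s * r))ᶜ.indicator f with hg
  have hgb : IsBddCompactlySupported g := hf.indicator (measurableSet_ball ϰ c _).compl
  obtain ⟨ns, hns⟩ := exists_subseq_tendsto_applyFun V ϰ T (hgb.memLp 2)
  have hker := ae_all_iff.2 fun j => (hK j).2 g hgb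
  -- The radius `a = s r` handles points with `ρ < 1`, and `a = max (s r) 1` those with `ρ ≥ 1`.
  -- Both are at least `r`, so `x` lies in `B(c, a)` and the annulus estimate applies.
  let G : ℝ → Space n₁ n₂ → ℝ≥0∞ := fun a => {w | a ≤ dist ϰ c w}.indicator fun w =>
    ENNReal.ofReal ((a / dist ϰ c w) ^ ε / boxVol ϰ c (dist ϰ c w)) * ‖f w‖ₑ
  have hset : ∀ a : ℝ, MeasurableSet {w | a ≤ dist ϰ c w} := fun a =>
    measurable_dist_right ϰ c measurableSet_Ici
  have hGm : ∀ a, Measurable (G a) := fun a => by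
    have h1 := measurable_dist_right ϰ c
    have h2 := measurable_boxVol_dist ϰ c
    have h3 := hf.1
    exact Measurable.indicator (by fun_prop) (hset a)
  have hGle : ∀ a, r ≤ a → ∫⁻ w, G a w ≤ D * maximal ϰ f x := by
    intro a ha
    rw [lintegral_indicator (hset a)]
    exact hD f c x a (hr.trans_le ha) (lt_of_lt_of_le (show dist ϰ c x < r from hx) ha)
  have hpt : ∀ y ∈ ball ϰ c r, ∀ z ∈ ball ϰ c r, ∀ (J : ℕ) (w : Space n₁ n₂),
      ∑ j ∈ Finset.range J, ‖K j y w - K j z w‖ₑ * ‖g w‖ₑ ≤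
        C.toNNReal * (G (s * r) w + G (max (s * r) 1) w) := by
    intro y hy z hz J w
    rcases lt_or_ge (dist ϰ c w) (s * r) with hw | hw
    · have hwB : w ∈ ball ϰ c (s * r) := hw
      have : g w = 0 := Set.indicator_of_notMem (Set.notMem_compl_iff.2 hwB) f
      simp [this]
    have hwB : w ∉ ball ϰ c (s * r) := fun h => not_lt.2 hw h
    have hgw : g w = f w := Set.indicator_of_mem (Set.mem_compl hwB) f
    set ρ := dist ϰ c w with hρ
    have hρ0 : 0 < ρ := by nlinarith
    have hV0 := boxVol_pos ϰ c hρ0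
    have hbound : ∀ a : ℝ, 0 < a → a ≤ ρ → (if ρ < 1 then r else 1) ≤ a →
        ∑ j ∈ Finset.range J, ‖K j y w - K j z w‖ₑ * ‖g w‖ₑ ≤ C.toNNReal * G a w := by
      intro a ha haρ hle
      have h1 : ∑ j ∈ Finset.range J, ‖K j y w - K j z w‖ ≤
          C * ((a / ρ) ^ ε / boxVol ϰ c ρ) := by
        rw [← mul_div_assoc, le_div_iff₀ hV0]
        refine (hsum J c w y z r hr hy hz hw).trans ?_
        have : 0 ≤ if ρ < 1 then r else 1 := by split_ifs <;> positivity
        gcongr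
      have h2 : G a w = ENNReal.ofReal ((a / ρ) ^ ε / boxVol ϰ c ρ) * ‖f w‖ₑ :=
        Set.indicator_of_mem (s := {w | a ≤ dist ϰ c w}) haρ _
      rw [← Finset.sum_mul, hgw, h2, ← mul_assoc]
      gcongr
      calc ∑ j ∈ Finset.range J, ‖K j y w - K j z w‖ₑ
          = ENNReal.ofReal (∑ j ∈ Finset.range J, ‖K j y w - K j z w‖) := by
            rw [ENNReal.ofReal_sum_of_nonneg fun _ _ => norm_nonneg _]
            simp only [ofReal_norm]
        _ ≤ ENNReal.ofReal (C * ((a / ρ) ^ ε / boxVol ϰ c ρ)) := ENNReal.ofReal_le_ofReal h1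
        _ = _ := ENNReal.ofReal_mul hC
    rcases lt_or_ge ρ 1 with hρ1 | hρ1
    · refine (hbound (s * r) (by positivity) hw (by rwa [if_pos hρ1])).trans ?_
      gcongr
      exact le_self_add
    · refine (hbound (max (s * r) 1) (by positivity) (max_le hw hρ1)
        (by rw [if_neg (not_lt.2 hρ1)]; exact le_max_right _ _)).trans ?_
      gcongr
      exact le_add_self
  filter_upwards [ae_prod_restrict_of_ae (hns.and hker) (measurableSet_ball ϰ c r)]
    with p ⟨⟨⟨hy1, hy2⟩, hyB⟩, ⟨hz1, hz2⟩, hzB⟩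
  -- The bound is uniform in the number of dyadic pieces, so it survives the almost everywhere limit
  -- along the subsequence.
  refine le_of_tendsto' (hy1.sub hz1).enorm fun i => ?_
  rw [← Finset.sum_sub_distrib]
  set J := ns i + 1
  calc ‖∑ j ∈ Finset.range J, (applyFun (T.comp (chi V ϰ n₁ n₂ j)) g p.1 -
          applyFun (T.comp (chi V ϰ n₁ n₂ j)) g p.2)‖ₑ
      ≤ ∑ j ∈ Finset.range J, ‖applyFun (T.comp (chi V ϰ n₁ n₂ j)) g p.1 -
          applyFun (T.comp (chi V ϰ n₁ n₂ j)) g p.2‖ₑ := enorm_sum_le _ _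
    _ ≤ ∑ j ∈ Finset.range J, ∫⁻ w, ‖K j p.1 w - K j p.2 w‖ₑ * ‖g w‖ₑ := by
        refine Finset.sum_le_sum fun j _ => ?_
        rw [(hy2 j).2, (hz2 j).2, ← integral_sub (hy2 j).1 (hz2 j).1]
        refine (enorm_integral_le_lintegral_enorm _).trans (le_of_eq ?_)
        simp only [← sub_mul, enorm_mul]
    _ ≤ ∫⁻ w, ∑ j ∈ Finset.range J, ‖K j p.1 w - K j p.2 w‖ₑ * ‖g w‖ₑ :=
        sum_lintegral_le_lintegral_sum _ _ _
    _ ≤ ∫⁻ w, C.toNNReal * (G (s * r) w + G (max (s * r) 1) w) :=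
        lintegral_mono fun w => hpt _ hyB _ hzB J w
    _ = C.toNNReal * ((∫⁻ w, G (s * r) w) + ∫⁻ w, G (max (s * r) 1) w) := by
        rw [lintegral_const_mul' _ _ ENNReal.coe_ne_top, lintegral_add_left (hGm _)]
    _ ≤ C.toNNReal * (D * maximal ϰ f x + D * maximal ϰ f x) := by
        gcongr
        · exact hGle _ hsr
        · exact hGle _ (le_max_of_le_left hsr)
    _ = _ := by push_cast; ring

/-! ### Extension to square integrable functions -/

lemma tendsto_eLpNorm_indicator_sub {α : Type*} [MeasurableSpace α] {μ : Measure α} {h : α → ℂ}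
    (hh : MemLp h 2 μ) {S : ℕ → Set α} (hS : ∀ n, MeasurableSet (S n))
    (hS' : ∀ x, ∀ᶠ n in atTop, x ∈ S n) :
    Tendsto (fun n => eLpNorm ((S n).indicator h - h) 2 μ) atTop (𝓝 0) := by
  have hlim : Tendsto (fun n => ∫⁻ a, ‖((S n).indicator h - h) a‖ₑ ^ (2 : ℝ) ∂μ) atTop (𝓝 0) := by
    rw [← lintegral_zero (μ := μ)]
    refine tendsto_lintegral_of_dominated_convergence' (fun a => ‖h a‖ₑ ^ (2 : ℝ)) (fun n => ?_)
      (fun n => Eventually.of_forall fun a => ?_) ?_ (Eventually.of_forall fun a => ?_)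
    · exact (((hh.1.indicator (hS n)).sub hh.1).enorm).pow_const _
    · by_cases ha : a ∈ S n <;> simp [ha]
    · have := lintegral_rpow_enorm_lt_top_of_eLpNorm_lt_top two_ne_zero ENNReal.ofNat_ne_top hh.2
      simpa using this.ne
    · refine tendsto_const_nhds.congr' ?_
      filter_upwards [hS' a] with n hn
      simp [hn]
  simp only [eLpNorm_eq_lintegral_rpow_enorm_toReal two_ne_zero ENNReal.ofNat_ne_top,
    ENNReal.toReal_ofNat]
  have := (ENNReal.continuous_rpow_const (y := 1 / 2)).tendsto 0 |>.comp hlim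
  simpa [Function.comp_def] using this

/-- Pointwise differences of `T f` outside a ball are controlled by the maximal function for all
square integrable `f` as soon as they are for bounded `f` with compact support. -/
lemma ae_enorm_sub_le_maximal_of_memLp {T : L2 n₁ n₂ →L[ℂ] L2 n₁ n₂} {C : ℝ≥0}
    {c x : Space n₁ n₂} {r R : ℝ}
    (hT : ∀ f : Space n₁ n₂ → ℂ, IsBddCompactlySupported f →
      ∀ᵐ p ∂(volume.restrict (ball ϰ c r)).prod (volume.restrict (ball ϰ c r)),
        ‖applyFun T ((ball ϰ c R)ᶜ.indicator f) p.1 -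
          applyFun T ((ball ϰ c R)ᶜ.indicator f) p.2‖ₑ ≤ C * maximal ϰ f x)
    {f : Space n₁ n₂ → ℂ} (hf : MemLp f 2 volume) :
    ∀ᵐ p ∂(volume.restrict (ball ϰ c r)).prod (volume.restrict (ball ϰ c r)),
        ‖applyFun T ((ball ϰ c R)ᶜ.indicator f) p.1 -
          applyFun T ((ball ϰ c R)ᶜ.indicator f) p.2‖ₑ ≤ C * maximal ϰ f x := by
  set E := (ball ϰ c R)ᶜ with hE
  have hEm : MeasurableSet E := (measurableSet_ball ϰ c R).compl
  set h := hf.1.mk f with hh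
  have hhm : Measurable h := hf.1.stronglyMeasurable_mk.measurable
  have hfh : f =ᵐ[volume] h := hf.1.ae_eq_mk
  -- Truncating in space and in height gives admissible functions converging to `f` in `L²`. Their
  -- modulus is at most `|f|` almost everywhere, so their maximal functions do not exceed that of
  -- `f`.
  let S : ℕ → Set (Space n₁ n₂) := fun n => {w | ‖w‖ ≤ n} ∩ {w | ‖h w‖ ≤ n}
  have hSm : ∀ n, MeasurableSet (S n) := fun n =>
    (measurableSet_le (by fun_prop) (by fun_prop)).inter
      (measurableSet_le (by fun_prop) (by fun_prop))
  have hS : ∀ w, ∀ᶠ n in atTop, w ∈ S n := fun w =>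
    ((tendsto_natCast_atTop_atTop (R := ℝ)).eventually_ge_atTop ‖w‖).and
      ((tendsto_natCast_atTop_atTop (R := ℝ)).eventually_ge_atTop ‖h w‖)
  have hb : ∀ n, IsBddCompactlySupported ((S n).indicator h) := fun n => by
    refine ⟨hhm.indicator (hSm n), ⟨n, fun w => ?_⟩, ?_⟩
    · by_cases hw : w ∈ S n
      · simpa [hw] using hw.2
      · simp [hw]
    · refine HasCompactSupport.intro (isCompact_closedBall (0 : Space n₁ n₂) n) fun w hw => ?_
      refine Set.indicator_of_notMem (fun hw' => hw ?_) h
      simpa using hw'.1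
  have hmem : MemLp (E.indicator f) 2 volume := hf.indicator hEm
  have hmemn : ∀ n, MemLp (E.indicator ((S n).indicator h)) 2 volume := fun n =>
    ((hb n).memLp 2).indicator hEm
  have hL : Tendsto (fun n => (hmemn n).toLp) atTop (𝓝 hmem.toLp) := by
    rw [Lp.tendsto_Lp_iff_tendsto_eLpNorm'']
    refine (tendsto_eLpNorm_indicator_sub hmem hSm hS).congr fun n => eLpNorm_congr_ae ?_
    filter_upwards [hfh] with w hw
    by_cases h1 : w ∈ E <;> by_cases h2 : w ∈ S n <;> simp [h1, h2, hw]
  obtain ⟨ns, -, hns⟩ := (tendstoInMeasure_of_tendsto_Lp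
    ((T.continuous.tendsto _).comp hL)).exists_seq_tendsto_ae
  have hTn := ae_all_iff.2 fun n => hT _ (hb n)
  filter_upwards [ae_prod_restrict_of_ae hns (measurableSet_ball ϰ c r), hTn]
    with p hyz hp
  obtain ⟨⟨hy, -⟩, hz, -⟩ := hyz
  simp only [applyFun, dif_pos hmem]
  refine le_of_tendsto' (hy.sub hz).enorm fun i => ?_
  have h1 := hp (ns i)
  simp only [applyFun, dif_pos (hmemn (ns i))] at h1
  refine h1.trans ?_
  gcongr
  refine maximal_mono ϰ ?_ x
  filter_upwards [hfh] with w hw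
  rw [hw]
  exact enorm_indicator_le_enorm_self h w

lemma exists_grandMaximal_le_maximal (V : Potential) (hn₁ : 1 ≤ n₁) (hC₀ : 1 < C₀)
    (hquasi : ∀ x y z : Space n₁ n₂, dist ϰ x y ≤ C₀ * (dist ϰ x z + dist ϰ z y))
    (hs : 2 * C₀ ≤ s) (T : L2 n₁ n₂ →L[ℂ] L2 n₁ n₂)
    (hK : ∀ j, IsIntegralKernel (T.comp (chi V ϰ n₁ n₂ j)) (K j))
    (hR₀ : homDim ϰ n₁ n₂ < R₀) (hsup : KernelSup ϰ K R₀) (hgrad : KernelGradSup ϰ K R₀) :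
    ∃ C : ℝ≥0, ∀ f : Space n₁ n₂ → ℂ, MemLp f 2 volume →
      ∀ x, grandMaximal ϰ T s f x ≤ C * maximal ϰ f x := by
  obtain ⟨C, hC⟩ := exists_ae_enorm_sub_le_maximal V hn₁ hC₀ hquasi hs T hK hR₀ hsup hgrad
  refine ⟨C, fun f hf x => ?_⟩
  refine iSup_le fun c => iSup_le fun r => iSup_le fun hr => iSup_le fun hx => ?_
  exact essSup_le_of_ae_le _
    (ae_enorm_sub_le_maximal_of_memLp (fun f hf => hC f hf c x r hr hx) hf)

end Grushin

/-! ### Pointwise domination and weak type `(1, 1)` -/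

theorem mainTheorem7 (n₁ n₂ ϰ : ℕ) (hn₁ : 1 ≤ n₁) (hn₂ : 1 ≤ n₂) (hϰ : 1 ≤ ϰ)
    (V : Grushin.Potential)
    (C₀ : ℝ) (hC₀ : 1 < C₀)
    (hquasi : ∀ x y z : Grushin.Space n₁ n₂,
      Grushin.dist ϰ x y ≤ C₀ * (Grushin.dist ϰ x z + Grushin.dist ϰ z y))
    (C₁ : ℝ) (hC₁ : 1 ≤ C₁)
    (δ₀ : ℝ) (hδ₀ : 0 < δ₀) (hδ₀' : δ₀ < 1)
    (s : ℝ) (hs : s = 8 * C₁ * C₀ ^ 3 / δ₀)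
    (T : Grushin.L2 n₁ n₂ →L[ℂ] Grushin.L2 n₁ n₂)
    (K : ℕ → Grushin.Space n₁ n₂ → Grushin.Space n₁ n₂ → ℂ)
    (hK : ∀ j, Grushin.IsIntegralKernel (T.comp (Grushin.chi V ϰ n₁ n₂ j)) (K j))
    (R₀ : ℝ) (hR₀ : Grushin.homDim ϰ n₁ n₂ < R₀)
    (hsup : Grushin.KernelSup ϰ K R₀)
    (hgrad : Grushin.KernelGradSup ϰ K R₀) :
    (∃ C : ℝ≥0, ∀ f : Grushin.Space n₁ n₂ → ℂ, Grushin.IsBddCompactlySupported f →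
      ∀ᵐ x, Grushin.grandMaximal ϰ T s f x ≤ C * Grushin.maximal ϰ f x) ∧
    (∃ C : ℝ≥0, ∀ f : Grushin.Space n₁ n₂ → ℂ, MemLp f 1 volume → MemLp f 2 volume →
      ∀ t : ℝ≥0, 0 < t →
        volume {x | (t : ℝ≥0∞) < Grushin.grandMaximal ϰ T s f x} ≤
          C * eLpNorm f 1 volume / t) := by
  have hs2 : 2 * C₀ ≤ s := by
    rw [hs, le_div_iff₀ hδ₀]
    have h1 : 2 * C₀ * δ₀ ≤ 2 * C₀ := by nlinarith
    have h2 : C₀ ≤ C₀ ^ 3 := le_self_pow₀ hC₀.le (by norm_num)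
    have h3 : C₀ ^ 3 ≤ C₁ * C₀ ^ 3 := le_mul_of_one_le_left (by positivity) hC₁
    linarith
  obtain ⟨C, hC⟩ :=
    Grushin.exists_grandMaximal_le_maximal V hn₁ hC₀ hquasi hs2 T hK hR₀ hsup hgrad
  refine ⟨⟨C, fun f hf => Filter.Eventually.of_forall fun x => hC f (hf.memLp 2) x⟩, ?_⟩
  obtain ⟨D, hD⟩ := Grushin.exists_volume_lt_maximal_le hn₁ hC₀ hquasi
  -- `C + 1` replaces `C` so that the level `t` can be divided by a nonzero constant.
  refine ⟨D * (C + 1), fun f hf1 hf2 t ht => ?_⟩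
  have hf : ∫⁻ y, ‖f y‖ₑ ≠ ⊤ := by
    rw [← eLpNorm_one_eq_lintegral_enorm]
    exact hf1.2.ne
  have hC0 : ((C + 1 : ℝ≥0) : ℝ≥0∞) ≠ 0 := by simp
  have hsub : {x | (t : ℝ≥0∞) < Grushin.grandMaximal ϰ T s f x} ⊆
      {x | (t : ℝ≥0∞) / (C + 1 : ℝ≥0) < Grushin.maximal ϰ f x} := by
    intro x hx
    have h1 : (t : ℝ≥0∞) < Grushin.grandMaximal ϰ T s f x := hx
    refine ENNReal.div_lt_of_lt_mul' (h1.trans_le ((hC f hf2 x).trans ?_))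
    gcongr
    exact le_self_add
  refine (measure_mono hsub).trans ((hD f hf _ ?_ ?_).trans (le_of_eq ?_))
  · exact ENNReal.div_pos (by exact_mod_cast ht.ne') ENNReal.coe_ne_top
  · exact ENNReal.div_ne_top ENNReal.coe_ne_top hC0
  · rw [eLpNorm_one_eq_lintegral_enorm, ENNReal.div_eq_inv_mul,
      ENNReal.inv_div (Or.inl ENNReal.coe_ne_top) (Or.inl hC0), ENNReal.coe_mul]
    simp only [div_eq_mul_inv]
    ring
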